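/- For a congruence subgroup $\varGamma\subset\mathrm{SL}_2(\mathbb Z)$ and an integer $k\ge 0$ let $\mathcal M(\varGamma)_k$ be the $\mathbb C$-vector space of holomorphic modular forms of weight $k$ for $\varGamma$ (holomorphic on the upper half plane and at all cusps), and let $\mathcal M(\varGamma)_{\ast}=\bigoplus_{k\ge 0}\mathcal M(\varGamma)_k$ be the graded ring of modular forms. Let $\Gamma(N)$ be the principal congruence subgroup of level $N$. For $\tau$ in the upper half plane put $q=e^{2\pi i\tau}$ and \[\eta(\tau)=e^{2\pi i\tau/24}\prod_{n\ge1}(1-q^n),\qquad E_{1,2}(\tau)=1-24\sum_{n\ge1}\Big(\sum_{d\mid n}d\Big)q^n,\] \[E_{2,2}(\tau)=2E_{1,2}(2\tau)-E_{1,2}(\tau),\qquad E_{\chi_3}(\tau)=1-\frac{2}{B_{\chi_3}}\sum_{n\ge1}\Big(\sum_{d\mid n}\chi_3(d)\Big)q^n=1+6\sum_{n\ge1}\Big(\sum_{d\mid n}\chi_3(d)\Big)q^n,\] where $\chi_3=\left(\frac{\cdot}{3}\right)$ is the nontrivial Dirichlet character modulo $3$ and $B_{\chi_3}=\frac13\sum_{a=1}^{3}\chi_3(a)\,a=-\frac13$.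 Put \[\eta^{\flat}(\tau)=\frac{\eta(\tau/2)^2}{\eta(\tau)},\quad \eta^{\sharp}(\tau)=\frac{\eta(2\tau)^2}{\eta(\tau)},\quad \eta^{\bot}(\tau)=\frac{\eta(\tau/3)^3}{\eta(\tau)},\quad \eta^{\top}(\tau)=\frac{\eta(3\tau)^3}{\eta(\tau)}.\] (1) The functions $E_{2,2}(\tau/2)$, $E_{2,2}(\tau)$, $(\eta^{\flat})^4$, $(\eta^{\sharp})^4$ belong to $\mathcal M(\Gamma(2))_2$, and \[\mathcal M(\Gamma(2))_{\ast}=\mathbb C\big[E_{2,2}(\tau/2),E_{2,2}(\tau)\big]=\mathbb C\big[(\eta^{\flat})^4,(\eta^{\sharp})^4\big].\] (2) The functions $E_{\chi_3}(\tau/3)$, $E_{\chi_3}(\tau)$, $\eta^{\bot}$, $\eta^{\top}$ belong to $\mathcal M(\Gamma(3))_1$, and \[\mathcal M(\Gamma(3))_{\ast}=\mathbb C\big[E_{\chi_3}(\tau/3),E_{\chi_3}(\tau)\big]=\mathbb C\big[\eta^{\bot},\eta^{\top}\big].\] In each of the four presentations $\mathbb C[x,y]$ the two generators $x,y$ are algebraically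 independent over $\mathbb C$, so that the graded ring is a polynomial ring in two variables. -/

import Mathlib

open UpperHalfPlane

open scoped DirectSum CongruenceSubgroup

noncomputable section

/-- The space of modular forms of weight `k ≥ 0` for `Γ`, as a space of functions on the upper half
plane. -/
def modularForms (Γ : Subgroup (GL (Fin 2) ℝ)) [Γ.HasDetOne] (k : ℕ) : Submodule ℂ (ℍ → ℂ) where
  carrier := {f | ∃ g : ModularForm Γ (k : ℤ), ⇑g = f}
  add_mem' := by
    rintro _ _ ⟨f, rfl⟩ ⟨g, rfl⟩
    exact ⟨f + g, FunLike.coe_add f g⟩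
  zero_mem' := ⟨0, FunLike.coe_zero⟩
  smul_mem' := by
    rintro c _ ⟨f, rfl⟩
    exact ⟨c • f, FunLike.coe_smul c f⟩

/-- Products of forms are forms and the weights add up; hence `⨁ k, modularForms Γ k` is a graded
commutative `ℂ`-algebra. -/
instance modularForms.instGradedMonoid (Γ : Subgroup (GL (Fin 2) ℝ)) [Γ.HasDetOne] :
    SetLike.GradedMonoid (modularForms Γ) where
  one_mem := ⟨ModularForm.mcast (by simp) (1 : ModularForm Γ 0), rfl⟩
  mul_mem := by
    rintro i j _ _ ⟨f, rfl⟩ ⟨g, rfl⟩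
    exact ⟨ModularForm.mcast (by simp) (f.mul g), rfl⟩

/-- The graded ring of all modular forms of weight `0, 1, 2, …` for `Γ`. -/
abbrev ModularFormRing (Γ : Subgroup (GL (Fin 2) ℝ)) [Γ.HasDetOne] : Type :=
  ⨁ k : ℕ, modularForms Γ k

/-- A form of weight `k`, seen as a homogeneous element of the graded ring. -/
def ModularFormRing.ofForm {Γ : Subgroup (GL (Fin 2) ℝ)} [Γ.HasDetOne] {k : ℕ}
    (f : modularForms Γ k) : ModularFormRing Γ :=
  DirectSum.of (fun i : ℕ => modularForms Γ i) k f

/-- The `ℂ`-algebra `R` is `ℂ[x, y]`, a polynomial ring in the two elements `x` and `y`. -/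
def IsPolynomialRingIn {R : Type*} [CommRing R] [Algebra ℂ R] (x y : R) : Prop :=
  AlgebraicIndependent ℂ ![x, y] ∧ Algebra.adjoin ℂ {x, y} = ⊤

/-- The function `τ ↦ f (h τ)`, for a real number `h > 0`. -/
def rescale (h : ℝ) (hh : 0 < h) (f : ℍ → ℂ) : ℍ → ℂ :=
  fun τ => f ((⟨h, hh⟩ : {x : ℝ // 0 < x}) • τ)

/-- `E_{2,2}(τ) = 2 E_{1,2}(2τ) - E_{1,2}(τ)`, where `E_{1,2} = 1 - 24 q - ⋯` is the normalised
Eisenstein series of weight two and level one. -/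
def eisensteinTwoTwo : ℍ → ℂ :=
  fun τ => 2 * rescale 2 two_pos EisensteinSeries.E2 τ - EisensteinSeries.E2 τ

/-- The first generalised Bernoulli number of a primitive Dirichlet character modulo `N`. -/
def bernoulliOne {N : ℕ} (χ : DirichletCharacter ℂ N) : ℂ :=
  (1 / (N : ℂ)) * ∑ a ∈ Finset.Icc 1 N, χ (a : ZMod N) * (a : ℂ)

/-- The Eisenstein series `E_χ = 1 - (2 / B_χ) ∑_{n ≥ 1} (∑_{d ∣ n} χ(d)) q^n` of weight one, for an
odd primitive Dirichlet character `χ`. -/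
def eisensteinWeightOne {N : ℕ} (χ : DirichletCharacter ℂ N) : ℍ → ℂ :=
  fun τ => 1 - (2 / bernoulliOne χ) *
    ∑' n : ℕ+, (∑ d ∈ (n : ℕ).divisors, χ (d : ZMod N)) *
      Complex.exp (2 * Real.pi * Complex.I * (τ : ℂ)) ^ (n : ℕ)

/-- The quadratic (Legendre) character modulo three. -/
def chiThree : DirichletCharacter ℂ 3 :=
  (quadraticChar (ZMod 3)).ringHomComp (Int.castRingHom ℂ)

/-- The eta quotient `η(τ/n)^n / η(τ)`. -/
def etaLower (n : ℕ) : ℍ → ℂ :=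
  fun τ => ModularForm.eta ((τ : ℂ) / n) ^ n / ModularForm.eta τ

/-- The eta quotient `η(nτ)^n / η(τ)`. -/
def etaUpper (n : ℕ) : ℍ → ℂ :=
  fun τ => ModularForm.eta (n * (τ : ℂ)) ^ n / ModularForm.eta τ

end

/-!
Let `y` be the power of `η(Nτ)^N / η(τ)` that has weight `w` and a simple zero in `e^{2πiτ/N}` at
`i∞`; such a power exists for `N = 2`, `w = 2` and for `N = 3`, `w = 1`. It has no zero on the upper
half plane, and none at the cusps `a/c` with `N ∤ c`, where it turns into a nonzero multiple of a
power of `η(τ/N)^N / η(τ)`. A form `f` for `Γ(N)` that vanishes at `i∞` therefore is a multiple of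
`y` in the ring of modular forms. So every `f` is known modulo `y` from its value at `i∞`, and by
induction on the weight `y` generates the ring together with any form `x` of weight `w` such that
`x(i∞) = 1`. Letting `τ` tend to `i∞` in a polynomial relation shows that `x` and `y` are
algebraically independent.

The multiplier system of `η` is not needed: the 24th powers of the eta quotients are quotients of
values of the discriminant, and whatever depends only on absolute values can be read off from them.

An Eisenstein series `E` with `E(i∞) = 1` which the Fricke involution multiplies by a constant gives
the form `E(τ/N) - E(τ)`. It vanishes at `i∞`, hence is a nonzero multiple of `y`; this puts `y` and
all the other generators into the space of modular forms at once. For `E_{2,2}` the involution comes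
from the transformation of the Eisenstein series of weight two. For `E_{χ₃}` it comes from the
Weierstrass zeta function of the lattice `ℤ τ + ℤ`, whose values at `1/3` and `τ/3` are exchanged by
`τ ↦ -1/τ` up to the factor `τ`.
-/

section

open Filter Topology ModularGroup
open Finset.HasAntidiagonal (antidiagonal mem_antidiagonal)
open scoped ModularForm MatrixGroups Manifold Real

section Homogeneous

theorem eq_zero_of_sum_antidiagonal_mul_pow_eq_zero {α 𝕜 : Type*} [NormedField 𝕜] {l : Filter α}
    [l.NeBot] {x y : α → 𝕜} {a : 𝕜} (ha : a ≠ 0) (hx : Tendsto x l (𝓝 a))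
    (hy : Tendsto y l (𝓝 0)) (hy0 : ∀ t, y t ≠ 0) {d : ℕ} {c : ℕ × ℕ → 𝕜}
    (h : ∀ t, ∑ p ∈ antidiagonal d, c p * (x t ^ p.1 * y t ^ p.2) = 0) :
    ∀ p ∈ antidiagonal d, c p = 0 := by
  induction d generalizing c with
  | zero => simpa using h (Classical.choice l.nonempty_of_neBot)
  | succ d ih =>
    have hsum (t : α) : c (d + 1, 0) * x t ^ (d + 1) +
        y t * ∑ p ∈ antidiagonal d, c (p.1, p.2 + 1) * (x t ^ p.1 * y t ^ p.2) = 0 := by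
      rw [← h t, Finset.Nat.sum_antidiagonal_succ', Finset.mul_sum]
      exact congr_arg₂ _ (by ring) (Finset.sum_congr rfl fun p _ ↦ by ring)
    have hlim := ((hx.pow (d + 1)).const_mul (c (d + 1, 0))).add (hy.mul
      (tendsto_finsetSum (antidiagonal d) fun p _ ↦
        ((hx.pow p.1).mul (hy.pow p.2)).const_mul (c (p.1, p.2 + 1))))
    have hlead : c (d + 1, 0) = 0 := by
      have := tendsto_nhds_unique (tendsto_const_nhds.congr fun t ↦ (hsum t).symm) hlim
      simpa [pow_ne_zero _ ha] using this.symm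
    have htail := ih fun t ↦ (mul_eq_zero.mp (by simpa [hlead] using hsum t)).resolve_left (hy0 t)
    rintro ⟨i, j⟩ hij
    rw [mem_antidiagonal] at hij
    cases j with
    | zero => rwa [show i = d + 1 from hij]
    | succ j => exact htail (i, j) (mem_antidiagonal.mpr (by omega))

end Homogeneous

section PolynomialRing

variable {R : Type*} [CommRing R] [Algebra ℂ R] {x y : R}

theorem IsPolynomialRingIn.sub_right (h : IsPolynomialRingIn x y) :
    IsPolynomialRingIn x (x - y) := by
  obtain ⟨hind, htop⟩ := h
  constructor
  · let φ : MvPolynomial (Fin 2) ℂ →ₐ[ℂ] MvPolynomial (Fin 2) ℂ :=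
      MvPolynomial.aeval ![MvPolynomial.X 0, MvPolynomial.X 0 - MvPolynomial.X 1]
    have hφφ : φ.comp φ = AlgHom.id ℂ _ := by
      ext i
      fin_cases i <;> simp [φ]
    have hcomp : MvPolynomial.aeval ![x, x - y] = (MvPolynomial.aeval ![x, y]).comp φ := by
      ext i
      fin_cases i <;> simp [φ]
    have hφ : Function.Involutive φ := DFunLike.congr_fun hφφ
    have hinj := Function.Injective.comp hind hφ.injective
    rwa [← AlgHom.coe_comp, ← hcomp] at hinj
  · have hx : x ∈ Algebra.adjoin ℂ {x, x - y} := Algebra.subset_adjoin (by simp)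
    rw [eq_top_iff, ← htop, Algebra.adjoin_le_iff]
    have hy : x - (x - y) ∈ Algebra.adjoin ℂ {x, x - y} :=
      sub_mem hx (Algebra.subset_adjoin (by simp))
    rw [sub_sub_cancel] at hy
    exact Set.insert_subset hx (Set.singleton_subset_iff.mpr hy)

end PolynomialRing

namespace ModularFormRing

variable {Γ : Subgroup (GL (Fin 2) ℝ)} [Γ.HasDetOne] {w : ℕ}

theorem of_pow_mul_of_pow_apply (x y : modularForms Γ w) (i j d : ℕ) :
    (((ofForm x ^ i * ofForm y ^ j : ModularFormRing Γ) d : modularForms Γ d) : ℍ → ℂ) =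
      if (i + j) * w = d then (x : ℍ → ℂ) ^ i * (y : ℍ → ℂ) ^ j else 0 := by
  rw [ofForm, ofForm, DirectSum.ofPow, DirectSum.ofPow, DirectSum.of_mul_of]
  split_ifs with h
  · subst h
    rw [show (i + j) * w = i • w + j • w by simp [add_mul], DirectSum.of_eq_same]
    rfl
  · rw [DirectSum.of_eq_of_ne _ _ _ (by simpa [← add_mul, eq_comm] using h)]
    rfl

theorem coe_aeval_apply (hw : 0 < w) (x y : modularForms Γ w) (P : MvPolynomial (Fin 2) ℂ)
    (d : ℕ) :
    ((MvPolynomial.aeval ![ofForm x, ofForm y] P (d * w) : modularForms Γ (d * w)) : ℍ → ℂ) =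
      ∑ n ∈ P.support with n 0 + n 1 = d,
        P.coeff n • ((x : ℍ → ℂ) ^ n 0 * (y : ℍ → ℂ) ^ n 1) := by
  rw [MvPolynomial.aeval_def, MvPolynomial.eval₂_eq']
  simp only [Fin.prod_univ_two, Matrix.cons_val_zero, Matrix.cons_val_one, ← Algebra.smul_def,
    DirectSum.sum_apply]
  rw [AddSubmonoidClass.coe_finsetSum, Finset.sum_filter]
  refine Finset.sum_congr rfl fun n _ ↦ ?_
  simp only [DirectSum.smul_apply, Submodule.coe_smul, of_pow_mul_of_pow_apply,
    Nat.mul_left_inj hw.ne']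
  split_ifs <;> simp

/-- The exponent of the monomial `X 0 ^ i * X 1 ^ j`, as the pair `(i, j)`. -/
noncomputable def exponentEquiv : (Fin 2 →₀ ℕ) ≃ ℕ × ℕ :=
  Finsupp.equivFunOnFinite.trans (finTwoArrowEquiv ℕ)

theorem sum_support_eq_sum_antidiagonal {M : Type*} [AddCommMonoid M] [Module ℂ M]
    (P : MvPolynomial (Fin 2) ℂ) (d : ℕ) (f : ℕ → ℕ → M) :
    ∑ n ∈ P.support with n 0 + n 1 = d, P.coeff n • f (n 0) (n 1) =
      ∑ p ∈ antidiagonal d, P.coeff (exponentEquiv.symm p) • f p.1 p.2 := by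
  refine Finset.sum_of_injOn exponentEquiv exponentEquiv.injective.injOn ?_ ?_ ?_
  · intro n hn
    simpa [exponentEquiv] using (Finset.mem_filter.mp hn).2
  · intro p hp hpn
    rw [MvPolynomial.notMem_support_iff.mp, zero_smul]
    intro hmem
    exact hpn ⟨_, Finset.mem_coe.mpr (Finset.mem_filter.mpr ⟨hmem, by
      simpa [exponentEquiv] using hp⟩), exponentEquiv.apply_symm_apply p⟩
  · intro n _
    rw [exponentEquiv.symm_apply_apply]
    rfl

theorem algebraicIndependent (hw : 0 < w) {x y : modularForms Γ w} {a : ℂ} (ha : a ≠ 0)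
    (hx : Tendsto (x : ℍ → ℂ) atImInfty (𝓝 a)) (hy : Tendsto (y : ℍ → ℂ) atImInfty (𝓝 0))
    (hy0 : ∀ τ, (y : ℍ → ℂ) τ ≠ 0) : AlgebraicIndependent ℂ ![ofForm x, ofForm y] := by
  rw [algebraicIndependent_iff]
  intro P hP
  ext n
  have hsum (τ : ℍ) : ∑ p ∈ antidiagonal (n 0 + n 1), P.coeff (exponentEquiv.symm p) *
      ((x : ℍ → ℂ) τ ^ p.1 * (y : ℍ → ℂ) τ ^ p.2) = 0 := by
    have h := coe_aeval_apply hw x y P (n 0 + n 1)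
    rw [hP, sum_support_eq_sum_antidiagonal P _
      fun i j ↦ (x : ℍ → ℂ) ^ i * (y : ℍ → ℂ) ^ j] at h
    simpa using (congrFun h τ).symm
  have hcoeff := eq_zero_of_sum_antidiagonal_mul_pow_eq_zero ha hx hy hy0 hsum (exponentEquiv n)
    (by simp [exponentEquiv])
  simpa using hcoeff

theorem ofForm_smul {k : ℕ} (c : ℂ) (f : modularForms Γ k) :
    ofForm (c • f) = c • (ofForm f : ModularFormRing Γ) :=
  (DirectSum.lof ℂ ℕ (fun i : ℕ ↦ modularForms Γ i) k).map_smul c f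

theorem ofForm_add {k : ℕ} (f g : modularForms Γ k) : ofForm (f + g) = ofForm f + ofForm g :=
  (DirectSum.of (fun i : ℕ ↦ modularForms Γ i) k).map_add f g

theorem ofForm_sub {k : ℕ} (f g : modularForms Γ k) : ofForm (f - g) = ofForm f - ofForm g :=
  map_sub (DirectSum.of (fun i : ℕ ↦ modularForms Γ i) k) f g

theorem ofForm_mul {i j k : ℕ} (hk : k = i + j) {f : modularForms Γ i} {g : modularForms Γ j}
    {p : modularForms Γ k} (hp : (p : ℍ → ℂ) = f * g) : ofForm p = ofForm f * ofForm g := by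
  subst hk
  rw [ofForm, ofForm, ofForm, DirectSum.of_mul_of]
  exact congrArg _ (Subtype.ext hp)

theorem ofForm_pow {n k : ℕ} (hk : k = n * w) {f : modularForms Γ w} {p : modularForms Γ k}
    (hp : (p : ℍ → ℂ) = (f : ℍ → ℂ) ^ n) : ofForm p = (ofForm f : ModularFormRing Γ) ^ n := by
  subst hk
  rw [ofForm, ofForm, DirectSum.ofPow]
  exact congrArg _ (Subtype.ext hp)

theorem ofForm_const (g : modularForms Γ 0) {c : ℂ} (hg : (g : ℍ → ℂ) = fun _ ↦ c) :
    ofForm g = algebraMap ℂ (ModularFormRing Γ) c := by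
  rw [Algebra.algebraMap_eq_smul_one]
  have h1 : (1 : ModularFormRing Γ) = ofForm ⟨1, SetLike.GradedOne.one_mem⟩ := rfl
  rw [h1, ← ofForm_smul]
  congr 1
  ext τ
  simp [hg]

theorem ofForm_eq_smul_pow_add_mul {n : ℕ} {x y : modularForms Γ w}
    {g : modularForms Γ ((n + 1) * w)} {h : modularForms Γ (n * w)} {c : ℂ}
    (hg : (g : ℍ → ℂ) = c • (x : ℍ → ℂ) ^ (n + 1) + h * y) :
    ofForm g = c • (ofForm x : ModularFormRing Γ) ^ (n + 1) + ofForm h * ofForm y := by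
  have hxn : (x : ℍ → ℂ) ^ (n + 1) ∈ modularForms Γ ((n + 1) * w) :=
    SetLike.pow_mem_graded (n + 1) x.2
  have hhy : (h * y : ℍ → ℂ) ∈ modularForms Γ ((n + 1) * w) := by
    rw [add_one_mul]
    exact SetLike.mul_mem_graded h.2 y.2
  have hsum : g = c • ⟨_, hxn⟩ + ⟨_, hhy⟩ := Subtype.ext hg
  rw [hsum, ofForm_add, ofForm_smul, ofForm_pow (p := ⟨_, hxn⟩) rfl rfl,
    ofForm_mul (p := ⟨_, hhy⟩) (add_one_mul n w) rfl]

/-- The hypotheses under which dividing by `y` shows that all modular forms for `Γ` are polynomials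
in the forms `x` and `y` of weight `w`: the remainder of a form modulo `y` is its value at `i∞`,
and `x` takes the value `1` there. -/
structure HasDivision (x y : modularForms Γ w) : Prop where
  const : ∀ g : modularForms Γ 0, ∃ c : ℂ, (g : ℍ → ℂ) = fun _ ↦ c
  eq_zero : ∀ k, ¬ w ∣ k → ∀ g : modularForms Γ k, g = 0
  lim : ∀ k, ∀ g : modularForms Γ k, ∃ c : ℂ, Tendsto (g : ℍ → ℂ) atImInfty (𝓝 c)
  div : ∀ k, ∀ g : modularForms Γ (k + w), Tendsto (g : ℍ → ℂ) atImInfty (𝓝 0) →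
    ∃ h : modularForms Γ k, (g : ℍ → ℂ) = h * y
  tendsto_left : Tendsto (x : ℍ → ℂ) atImInfty (𝓝 1)

namespace HasDivision

variable {x y : modularForms Γ w}

theorem exists_eq_smul_pow_add_mul (H : HasDivision x y) {n : ℕ}
    (g : modularForms Γ ((n + 1) * w)) :
    ∃ (c : ℂ) (h : modularForms Γ (n * w)),
      (g : ℍ → ℂ) = c • (x : ℍ → ℂ) ^ (n + 1) + h * y := by
  obtain ⟨c, hc⟩ := H.lim _ g
  have hmem : (g - c • (x : ℍ → ℂ) ^ (n + 1) : ℍ → ℂ) ∈ modularForms Γ (n * w + w) := by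
    rw [← add_one_mul]
    exact sub_mem g.2 (Submodule.smul_mem _ _ (SetLike.pow_mem_graded (n + 1) x.2))
  obtain ⟨h, hh⟩ := H.div _ ⟨_, hmem⟩ (by
    simpa using! hc.sub ((H.tendsto_left.pow (n + 1)).const_smul c))
  exact ⟨c, h, by rw [← hh, add_sub_cancel]⟩

theorem ofForm_mem_adjoin (H : HasDivision x y) (n : ℕ) {k : ℕ} (hk : k = n * w)
    (g : modularForms Γ k) : ofForm g ∈ Algebra.adjoin ℂ {ofForm x, ofForm y} := by
  induction n generalizing k with
  | zero =>
    obtain rfl : k = 0 := by simpa using hk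
    obtain ⟨c, hc⟩ := H.const g
    rw [ofForm_const g hc]
    exact Subalgebra.algebraMap_mem _ c
  | succ n ih =>
    subst hk
    obtain ⟨c, h, hg⟩ := H.exists_eq_smul_pow_add_mul g
    rw [ofForm_eq_smul_pow_add_mul hg]
    exact add_mem (Subalgebra.smul_mem _ (pow_mem (Algebra.subset_adjoin (by simp)) _) c)
      (mul_mem (ih rfl h) (Algebra.subset_adjoin (by simp)))

theorem adjoin_eq_top (H : HasDivision x y) : Algebra.adjoin ℂ {ofForm x, ofForm y} = ⊤ := by
  refine eq_top_iff.mpr fun r _ ↦ ?_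
  induction r using DirectSum.induction_on with
  | zero => exact zero_mem _
  | of k g =>
    by_cases hk : w ∣ k
    · obtain ⟨n, rfl⟩ := hk
      exact H.ofForm_mem_adjoin n (mul_comm w n) g
    · rw [H.eq_zero k hk g, map_zero]
      exact zero_mem _
  | add a b ha hb => exact add_mem (ha trivial) (hb trivial)

theorem isPolynomialRingIn (H : HasDivision x y) (hw : 0 < w)
    (hy : Tendsto (y : ℍ → ℂ) atImInfty (𝓝 0)) (hy0 : ∀ τ, (y : ℍ → ℂ) τ ≠ 0) :
    IsPolynomialRingIn (ofForm x) (ofForm y) :=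
  ⟨algebraicIndependent hw one_ne_zero H.tendsto_left hy hy0, H.adjoin_eq_top⟩

end HasDivision

end ModularFormRing

section CuspSubgroup

open Matrix.SpecialLinearGroup

/-- The subgroup of `SL(2, ℤ)` generated by the translation `τ ↦ τ + 1` and by the conjugate
`τ ↦ τ / (1 - N τ)` under `S` of the translation `τ ↦ τ + N`. For `N ≤ 3` it is `Γ₀(N)` up to
sign. -/
def cuspSubgroup (N : ℕ) : Subgroup SL(2, ℤ) :=
  Subgroup.closure {T, S * T ^ N * S⁻¹}

variable {N : ℕ}

theorem T_mem_cuspSubgroup : T ∈ cuspSubgroup N :=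
  Subgroup.subset_closure (by simp)

theorem S_mul_T_zpow_mul_S_inv_mem_cuspSubgroup (m : ℤ) :
    S * T ^ (N * m) * S⁻¹ ∈ cuspSubgroup N := by
  have h : S * T ^ (N * m) * S⁻¹ = (S * T ^ N * S⁻¹) ^ m := by
    rw [conj_zpow, zpow_mul, zpow_natCast]
  rw [h]
  exact zpow_mem (Subgroup.subset_closure (by simp)) m

theorem coe_S_mul_T_zpow_mul_S_inv (m : ℤ) :
    ((S * T ^ m * S⁻¹ : SL(2, ℤ)) : Matrix (Fin 2) (Fin 2) ℤ) = !![1, 0; -m, 1] := by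
  ext i j
  fin_cases i <;> fin_cases j <;> simp [coe_S, coe_T_zpow, Matrix.mul_apply, Fin.sum_univ_two]

theorem exists_two_mul_abs_add_mul_le (a : ℤ) {b : ℤ} (hb : b ≠ 0) :
    ∃ m : ℤ, 2 * |a + m * b| ≤ |b| := by
  refine ⟨-round (a / b : ℚ), ?_⟩
  have hb' : (0 : ℚ) < |(b : ℚ)| := abs_pos.mpr (mod_cast hb)
  have hround := mul_le_mul_of_nonneg_right (abs_sub_round (a / b : ℚ)) hb'.le
  rw [← abs_mul, sub_mul, div_mul_cancel₀ _ (mod_cast hb)] at hround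
  have : 2 * |(a : ℚ) + -round (a / b : ℚ) * b| ≤ |(b : ℚ)| := by
    rw [neg_mul, ← sub_eq_add_neg]
    linarith
  exact_mod_cast this

theorem mul_T_zpow_apply_one (γ : SL(2, ℤ)) (m : ℤ) :
    (γ * T ^ m) 1 0 = γ 1 0 ∧ (γ * T ^ m) 1 1 = γ 1 1 + m * γ 1 0 := by
  simp [coe_T_zpow, Matrix.mul_apply, Fin.sum_univ_two, add_comm, mul_comm]

theorem mul_S_mul_T_zpow_mul_S_inv_apply_one_zero (γ : SL(2, ℤ)) (m : ℤ) :
    (γ * (S * T ^ m * S⁻¹)) 1 0 = γ 1 0 + -m * γ 1 1 := by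
  rw [coe_mul, coe_S_mul_T_zpow_mul_S_inv]
  simp [Matrix.mul_apply, Fin.sum_univ_two, mul_comm]

theorem eq_T_zpow_or_neg_eq_T_zpow {γ : SL(2, ℤ)} (hγ : γ 1 0 = 0) :
    ∃ n : ℤ, γ = T ^ n ∨ -γ = T ^ n := by
  have hdet := γ.det_coe
  rw [Matrix.det_fin_two, hγ, mul_zero, sub_zero] at hdet
  obtain ⟨ha, hd⟩ | ⟨ha, hd⟩ := Int.mul_eq_one_iff_eq_one_or_neg_one.mp hdet
  · refine ⟨γ 0 1, Or.inl ?_⟩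
    ext i j
    fin_cases i <;> fin_cases j <;> simp [coe_T_zpow, ha, hd, hγ]
  · refine ⟨-γ 0 1, Or.inr ?_⟩
    ext i j
    fin_cases i <;> fin_cases j <;> simp [coe_T_zpow, ha, hd, hγ]

theorem exists_mul_abs_apply_one_zero_lt (hN2 : 2 ≤ N) (hN3 : N ≤ 3) {γ : SL(2, ℤ)}
    (hdvd : (N : ℤ) ∣ γ 1 0) (hγ : γ 1 0 ≠ 0) :
    ∃ δ ∈ cuspSubgroup N, (N : ℤ) ∣ (γ * δ) 1 0 ∧ |(γ * δ) 1 0| < |γ 1 0| := by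
  obtain ⟨m, hm⟩ := exists_two_mul_abs_add_mul_le (γ 1 1) hγ
  obtain ⟨hc, hd⟩ := mul_T_zpow_apply_one γ m
  rw [← hd] at hm
  have hd0 : (γ * T ^ m) 1 1 ≠ 0 := by
    intro h0
    have hdet := (γ * T ^ m).det_coe
    rw [Matrix.det_fin_two, h0, hc, mul_zero, zero_sub] at hdet
    have hunit : (N : ℤ) ∣ 1 := by
      rw [← hdet]
      exact (hdvd.mul_left _).neg_right
    have := Int.le_of_dvd one_pos hunit
    omega
  obtain ⟨n, hn⟩ := exists_two_mul_abs_add_mul_le (γ 1 0)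
    (mul_ne_zero (by positivity : (N : ℤ) ≠ 0) hd0)
  have hmul : γ * (T ^ m * (S * T ^ (N * -n) * S⁻¹)) = γ * T ^ m * (S * T ^ (N * -n) * S⁻¹) :=
    (mul_assoc _ _ _).symm
  have hcn : (γ * (T ^ m * (S * T ^ (N * -n) * S⁻¹))) 1 0 =
      γ 1 0 + n * (N * (γ * T ^ m) 1 1) := by
    rw [hmul, mul_S_mul_T_zpow_mul_S_inv_apply_one_zero, hc]
    ring
  refine ⟨_, mul_mem (zpow_mem T_mem_cuspSubgroup m)
    (S_mul_T_zpow_mul_S_inv_mem_cuspSubgroup (-n)), ?_, ?_⟩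
  · rw [hcn]
    exact dvd_add hdvd ((dvd_mul_right _ _).mul_left n)
  · rw [hcn]
    rw [abs_mul, Nat.abs_cast] at hn
    have hpos : 0 < |γ 1 0| := abs_pos.mpr hγ
    have hN : (N : ℤ) ≤ 3 := mod_cast hN3
    nlinarith [hpos, hN, abs_nonneg ((γ * T ^ m) 1 1)]

theorem mem_cuspSubgroup_or_neg_mem (hN2 : 2 ≤ N) (hN3 : N ≤ 3) {γ : SL(2, ℤ)}
    (hγ : (N : ℤ) ∣ γ 1 0) : γ ∈ cuspSubgroup N ∨ -γ ∈ cuspSubgroup N := by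
  induction hc : (γ 1 0).natAbs using Nat.strong_induction_on generalizing γ with
  | _ c ih =>
  by_cases h0 : γ 1 0 = 0
  · obtain ⟨n, hn⟩ := eq_T_zpow_or_neg_eq_T_zpow h0
    have hT : (T ^ n : SL(2, ℤ)) ∈ cuspSubgroup N := zpow_mem T_mem_cuspSubgroup n
    exact hn.imp (fun h ↦ by rwa [h]) (fun h ↦ by rwa [h])
  · obtain ⟨δ, hδ, hdvd, hlt⟩ := exists_mul_abs_apply_one_zero_lt hN2 hN3 hγ h0
    rw [Int.abs_eq_natAbs, Int.abs_eq_natAbs, Nat.cast_lt, hc] at hlt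
    have := ih _ hlt hdvd rfl
    rwa [← neg_mul, Subgroup.mul_mem_cancel_right _ hδ, Subgroup.mul_mem_cancel_right _ hδ] at this

theorem exists_dvd_mul_T_zpow_mul_S_inv_apply [Fact N.Prime] {γ : SL(2, ℤ)}
    (hγ : ¬ (N : ℤ) ∣ γ 1 0) : ∃ j : ℤ, (N : ℤ) ∣ (γ * T ^ (-j) * S⁻¹) 1 0 := by
  have hc : (γ 1 0 : ZMod N) ≠ 0 := by rwa [Ne, ZMod.intCast_zmod_eq_zero_iff_dvd]
  obtain ⟨j, hj⟩ := ZMod.intCast_surjective ((γ 1 1 : ZMod N) / (γ 1 0 : ZMod N))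
  refine ⟨j, ?_⟩
  obtain ⟨-, h1⟩ := mul_T_zpow_apply_one γ (-j)
  have hS : (γ * T ^ (-j) * S⁻¹) 1 0 = -(γ * T ^ (-j)) 1 1 := by
    rw [coe_mul]
    simp [coe_S, Matrix.mul_apply, Fin.sum_univ_two]
  rw [hS, h1, ← ZMod.intCast_zmod_eq_zero_iff_dvd]
  push_cast
  rw [hj, neg_mul, div_mul_cancel₀ _ hc, add_neg_cancel, neg_zero]

theorem cuspSubgroup_le_Gamma1 : cuspSubgroup N ≤ CongruenceSubgroup.Gamma1 N := by
  rw [cuspSubgroup, Subgroup.closure_le]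
  rintro _ (rfl | rfl)
  · simp [SetLike.mem_coe, CongruenceSubgroup.Gamma1_mem, coe_T]
  · rw [SetLike.mem_coe, CongruenceSubgroup.Gamma1_mem, ← zpow_natCast,
      coe_S_mul_T_zpow_mul_S_inv]
    simp

end CuspSubgroup

section Slash

theorem coe_S_smul (τ : ℍ) : ((S • τ : ℍ) : ℂ) = -1 / τ := by
  rw [UpperHalfPlane.modular_S_smul, UpperHalfPlane.coe_mk, inv_neg, neg_div, one_div]

theorem slash_S_apply (f : ℍ → ℂ) (k : ℤ) (τ : ℍ) :
    (f ∣[k] S) τ = f (S • τ) * (τ : ℂ) ^ (-k) := by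
  rw [ModularForm.SL_slash_apply, denom_S]

theorem slash_T_zpow_apply (f : ℍ → ℂ) (k n : ℤ) (τ : ℍ) :
    (f ∣[k] (T ^ n : SL(2, ℤ))) τ = f ((n : ℝ) +ᵥ τ) := by
  rw [ModularForm.SL_slash_apply, modular_T_zpow_smul, denom_apply]
  simp [coe_T_zpow]

theorem slash_T_apply (f : ℍ → ℂ) (k : ℤ) (τ : ℍ) : (f ∣[k] T) τ = f ((1 : ℝ) +ᵥ τ) := by
  simpa using slash_T_zpow_apply f k 1 τ

theorem slash_neg (f : ℍ → ℂ) (k : ℤ) (γ : SL(2, ℤ)) : f ∣[k] (-γ) = (-1 : ℂ) ^ k • f ∣[k] γ := by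
  ext τ
  have hden : (((-γ) 1 0 : ℤ) : ℂ) * τ + ((-γ) 1 1 : ℤ) = -1 * ((γ 1 0 : ℂ) * τ + γ 1 1) := by
    push_cast [Matrix.SpecialLinearGroup.coe_neg, Matrix.neg_apply]
    ring
  rw [Pi.smul_apply, smul_eq_mul, ModularForm.SL_slash_apply, ModularForm.SL_slash_apply,
    SL_neg_smul, denom_apply, denom_apply, hden, mul_zpow, zpow_neg, ← inv_zpow, inv_neg_one]
  ring

theorem pow_slash (f : ℍ → ℂ) (k : ℤ) (n : ℕ) (γ : SL(2, ℤ)) :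
    (f ^ n) ∣[n * k] γ = (f ∣[k] γ) ^ n := by
  induction n with
  | zero => simpa using ModularForm.is_invariant_one γ
  | succ n ih => rw [pow_succ, Nat.cast_succ, add_one_mul, ModularForm.mul_slash_SL2, ih, pow_succ]

theorem tendsto_vadd_atImInfty (x : ℝ) : Tendsto (fun τ : ℍ ↦ x +ᵥ τ) atImInfty atImInfty :=
  tendsto_comap_iff.mpr (tendsto_comap.congr fun τ ↦ (vadd_im x τ).symm)

theorem tendsto_slash_T_zpow {f : ℍ → ℂ} {l : Filter ℂ} (hf : Tendsto f atImInfty l)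
    (k n : ℤ) : Tendsto (f ∣[k] (T ^ n : SL(2, ℤ))) atImInfty l :=
  (hf.comp (tendsto_vadd_atImInfty n)).congr fun τ ↦ (slash_T_zpow_apply f k n τ).symm

theorem isBoundedAtImInfty_slash_T_zpow {f : ℍ → ℂ} (hf : IsBoundedAtImInfty f) (k n : ℤ) :
    IsBoundedAtImInfty (f ∣[k] (T ^ n : SL(2, ℤ))) :=
  (hf.comp_tendsto (tendsto_vadd_atImInfty n)).congr_left fun τ ↦ (slash_T_zpow_apply f k n τ).symm

end Slash

section Gamma

variable {N k : ℕ} {f : ℍ → ℂ}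

theorem mem_modularForms_Gamma_iff [NeZero N] :
    f ∈ modularForms Γ(N) k ↔ MDiff f ∧ (∀ γ ∈ CongruenceSubgroup.Gamma N, f ∣[(k : ℤ)] γ = f) ∧
      ∀ γ : SL(2, ℤ), IsBoundedAtImInfty (f ∣[(k : ℤ)] γ) := by
  constructor
  · rintro ⟨g, rfl⟩
    refine ⟨g.holo', fun γ hγ ↦ g.slash_action_eq' _ ⟨γ, hγ, rfl⟩, fun γ ↦ ?_⟩
    have hc : IsCusp (Matrix.SpecialLinearGroup.mapGL ℝ γ • OnePoint.infty) 𝒮ℒ :=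
      isCusp_SL2Z_iff'.mpr ⟨γ, rfl⟩
    have := g.bdd_at_cusps' ((Subgroup.IsArithmetic.isCusp_iff_isCusp_SL2Z _).mpr hc)
    exact (OnePoint.isBoundedAt_iff_forall_SL2Z hc).mp this γ rfl
  · rintro ⟨hd, hi, hb⟩
    exact ⟨{
      toFun := f
      slash_action_eq' := by
        rintro _ ⟨γ, hγ, rfl⟩
        exact hi γ hγ
      holo' := hd
      bdd_at_cusps' := fun hc ↦ by
        rw [Subgroup.IsArithmetic.isCusp_iff_isCusp_SL2Z] at hc
        exact (OnePoint.isBoundedAt_iff_forall_SL2Z hc).mpr fun γ _ ↦ hb γ }, rfl⟩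

theorem slash_mem_modularForms_Gamma [NeZero N] (hf : f ∈ modularForms Γ(N) k) (γ : SL(2, ℤ)) :
    f ∣[(k : ℤ)] γ ∈ modularForms Γ(N) k := by
  rw [mem_modularForms_Gamma_iff] at hf ⊢
  obtain ⟨hd, hi, hb⟩ := hf
  refine ⟨hd.slash k _, fun δ hδ ↦ ?_, fun δ ↦ ?_⟩
  · rw [← SlashAction.slash_mul, show γ * δ = γ * δ * γ⁻¹ * γ by group, SlashAction.slash_mul,
      hi _ ((CongruenceSubgroup.Gamma_normal N).conj_mem δ hδ γ)]
  · rw [← SlashAction.slash_mul]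
    exact hb _

theorem natCast_mem_strictPeriods_Gamma :
    (N : ℝ) ∈ (Γ(N) : Subgroup (GL (Fin 2) ℝ)).strictPeriods := by
  rw [CongruenceSubgroup.strictPeriods_Gamma]
  exact AddSubgroup.mem_zmultiples _

theorem exists_tendsto_of_mem_modularForms_Gamma [NeZero N] (hf : f ∈ modularForms Γ(N) k) :
    ∃ c : ℂ, Tendsto f atImInfty (𝓝 c) := by
  obtain ⟨g, rfl⟩ := hf
  have hN : (0 : ℝ) < N := mod_cast Nat.pos_of_neZero N
  refine ⟨cuspFunction N g 0, ?_⟩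
  have hc := (ModularFormClass.differentiableAt_cuspFunction g hN natCast_mem_strictPeriods_Gamma
    (q := 0) (by simp)).continuousAt
  refine (hc.tendsto.comp (qParam_tendsto_atImInfty hN)).congr fun τ ↦ ?_
  exact SlashInvariantFormClass.eq_cuspFunction g τ natCast_mem_strictPeriods_Gamma hN.ne'

theorem isBigO_exp_of_mem_modularForms_Gamma [NeZero N] (hf : f ∈ modularForms Γ(N) k)
    (h0 : Tendsto f atImInfty (𝓝 0)) :
    f =O[atImInfty] fun τ ↦ Real.exp (-2 * π * τ.im / N) := by
  have hb : IsBoundedAtImInfty f := by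
    simpa using (mem_modularForms_Gamma_iff.mp hf).2.2 1
  obtain ⟨g, rfl⟩ := hf
  exact IsZeroAtImInfty.exp_decay_atImInfty h0 (mod_cast Nat.pos_of_neZero N)
    (SlashInvariantFormClass.periodic_comp_ofComplex g natCast_mem_strictPeriods_Gamma) g.holo' hb

theorem slash_eq_slash_T_zpow_of_mem_Gamma1 [NeZero N] (hf : f ∈ modularForms Γ(N) k)
    {γ : SL(2, ℤ)} (hγ : γ ∈ CongruenceSubgroup.Gamma1 N) :
    f ∣[(k : ℤ)] γ = f ∣[(k : ℤ)] (T ^ γ 0 1 : SL(2, ℤ)) := by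
  obtain ⟨ha, hd, hc⟩ := (CongruenceSubgroup.Gamma1_mem N γ).mp hγ
  have hmem : γ * (T ^ (γ 0 1))⁻¹ ∈ CongruenceSubgroup.Gamma N := by
    rw [← zpow_neg, CongruenceSubgroup.Gamma_mem]
    simp [Matrix.SpecialLinearGroup.coe_mul, coe_T_zpow, Matrix.mul_apply, Fin.sum_univ_two,
      ha, hc, hd]
  conv_lhs => rw [← inv_mul_cancel_right γ (T ^ (γ 0 1)), SlashAction.slash_mul,
    (mem_modularForms_Gamma_iff.mp hf).2.1 _ hmem]

theorem tendsto_slash_zero_of_dvd (hN2 : 2 ≤ N) (hN3 : N ≤ 3) (hf : f ∈ modularForms Γ(N) k)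
    (h0 : Tendsto f atImInfty (𝓝 0)) {γ : SL(2, ℤ)} (hγ : (N : ℤ) ∣ γ 1 0) :
    Tendsto (f ∣[(k : ℤ)] γ) atImInfty (𝓝 0) := by
  have : NeZero N := ⟨by omega⟩
  have hslash {δ : SL(2, ℤ)} (hδ : δ ∈ cuspSubgroup N) :
      Tendsto (f ∣[(k : ℤ)] δ) atImInfty (𝓝 0) := by
    rw [slash_eq_slash_T_zpow_of_mem_Gamma1 hf (cuspSubgroup_le_Gamma1 hδ)]
    exact tendsto_slash_T_zpow h0 _ _
  obtain hmem | hmem := mem_cuspSubgroup_or_neg_mem hN2 hN3 hγ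
  · exact hslash hmem
  · rw [← neg_neg γ, slash_neg]
    simpa using! (hslash hmem).const_smul ((-1 : ℂ) ^ (k : ℤ))

end Gamma

/-- `f` is fixed in weight `k` by the two generators of `cuspSubgroup N`. -/
structure IsCuspInvariant (N : ℕ) (k : ℤ) (f : ℍ → ℂ) : Prop where
  slash_T : f ∣[k] T = f
  slash_S_slash_T_pow : (f ∣[k] S) ∣[k] (T ^ N : SL(2, ℤ)) = f ∣[k] S

namespace IsCuspInvariant

variable {N : ℕ} {f : ℍ → ℂ}

theorem slash_eq {k : ℤ} (h : IsCuspInvariant N k f) {γ : SL(2, ℤ)} (hγ : γ ∈ cuspSubgroup N) :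
    f ∣[k] γ = f := by
  induction hγ using Subgroup.closure_induction with
  | mem x hx =>
    obtain rfl | rfl := hx
    · exact h.slash_T
    · rw [SlashAction.slash_mul, SlashAction.slash_mul, h.slash_S_slash_T_pow,
        ← SlashAction.slash_mul, mul_inv_cancel, SlashAction.slash_one]
  | one => exact SlashAction.slash_one k f
  | mul x y _ _ hx hy => rw [SlashAction.slash_mul, hx, hy]
  | inv x _ hx =>
    conv_lhs => rw [← hx, ← SlashAction.slash_mul, mul_inv_cancel, SlashAction.slash_one]

theorem pow {k : ℤ} (h : IsCuspInvariant N k f) (n : ℕ) : IsCuspInvariant N (n * k) (f ^ n) where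
  slash_T := by rw [pow_slash, h.slash_T]
  slash_S_slash_T_pow := by rw [pow_slash, pow_slash, h.slash_S_slash_T_pow]

theorem exists_slash_eq_smul {k : ℤ} (h : IsCuspInvariant N k f) (hN2 : 2 ≤ N) (hN3 : N ≤ 3)
    {γ : SL(2, ℤ)} (hγ : (N : ℤ) ∣ γ 1 0) : ∃ ε : ℂ, ε ≠ 0 ∧ f ∣[k] γ = ε • f := by
  obtain hmem | hmem := mem_cuspSubgroup_or_neg_mem hN2 hN3 hγ
  · exact ⟨1, one_ne_zero, by rw [h.slash_eq hmem, one_smul]⟩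
  · exact ⟨(-1) ^ k, zpow_ne_zero _ (by norm_num), by
      rw [← neg_neg γ, slash_neg, h.slash_eq hmem]⟩

theorem exists_slash_eq_smul_slash_S {k : ℤ} (h : IsCuspInvariant N k f) (hN2 : 2 ≤ N)
    (hN3 : N ≤ 3) {γ : SL(2, ℤ)} (hγ : ¬ (N : ℤ) ∣ γ 1 0) :
    ∃ ε : ℂ, ε ≠ 0 ∧ ∃ j : ℤ, f ∣[k] γ = ε • (f ∣[k] S) ∣[k] (T ^ j : SL(2, ℤ)) := by
  have : Fact N.Prime := ⟨by interval_cases N <;> norm_num⟩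
  obtain ⟨j, hj⟩ := exists_dvd_mul_T_zpow_mul_S_inv_apply hγ
  obtain ⟨ε, hε, h1⟩ := h.exists_slash_eq_smul hN2 hN3 hj
  refine ⟨ε, hε, j, ?_⟩
  have hγ' : γ = γ * T ^ (-j) * S⁻¹ * S * T ^ j := by group
  rw [hγ', SlashAction.slash_mul, SlashAction.slash_mul, h1, ModularForm.SL_smul_slash,
    ModularForm.SL_smul_slash]

theorem mem_modularForms_Gamma {k : ℕ} (h : IsCuspInvariant N k f) (hN2 : 2 ≤ N) (hN3 : N ≤ 3)
    (hk : N = 2 → Even k) (hd : MDiff f) (hb : IsBoundedAtImInfty f)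
    (hbS : IsBoundedAtImInfty (f ∣[(k : ℤ)] S)) : f ∈ modularForms Γ(N) k := by
  have : NeZero N := ⟨by omega⟩
  refine mem_modularForms_Gamma_iff.mpr ⟨hd, fun γ hγ ↦ ?_, fun γ ↦ ?_⟩
  · have hγN := CongruenceSubgroup.Gamma_mem.mp hγ
    obtain hmem | hmem := mem_cuspSubgroup_or_neg_mem hN2 hN3
      ((ZMod.intCast_zmod_eq_zero_iff_dvd _ _).mp hγN.2.2.1)
    · exact h.slash_eq hmem
    · have hneg : ((-γ) 0 0 : ZMod N) = 1 :=
        ((CongruenceSubgroup.Gamma1_mem N _).mp (cuspSubgroup_le_Gamma1 hmem)).1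
      have hkeven : Even k := hk (by
        by_contra hN
        obtain rfl : N = 3 := by omega
        exact absurd (by simpa [hγN.1] using hneg) (by decide : (-1 : ZMod 3) ≠ 1))
      rw [← neg_neg γ, slash_neg, h.slash_eq hmem, zpow_natCast, hkeven.neg_one_pow, one_smul]
  · by_cases hγ : (N : ℤ) ∣ γ 1 0
    · obtain ⟨ε, -, hslash⟩ := h.exists_slash_eq_smul hN2 hN3 hγ
      rw [hslash]
      exact hb.const_smul_left ε
    · obtain ⟨ε, -, j, hslash⟩ := h.exists_slash_eq_smul_slash_S hN2 hN3 hγ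
      rw [hslash]
      exact (isBoundedAtImInfty_slash_T_zpow hbS k j).const_smul_left ε

end IsCuspInvariant

section Rescale

variable {h : ℝ} {hh : 0 < h} {f : ℍ → ℂ}

theorem coe_pos_smul (hh : 0 < h) (τ : ℍ) :
    (((⟨h, hh⟩ : {x : ℝ // 0 < x}) • τ : ℍ) : ℂ) = h * τ := by
  rw [UpperHalfPlane.coe_pos_real_smul]
  rfl

theorem rescale_rescale_eq_self {h' : ℝ} {hh' : 0 < h'} (hmul : h * h' = 1) :
    rescale h hh (rescale h' hh' f) = f := by
  ext τ
  rw [rescale, rescale]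
  congr 1
  ext
  rw [coe_pos_smul, coe_pos_smul, ← mul_assoc, ← Complex.ofReal_mul, mul_comm h', hmul,
    Complex.ofReal_one, one_mul]

theorem rescale_slash_T_zpow {m n : ℤ} (hmn : h * n = m) (k : ℤ) :
    rescale h hh f ∣[k] (T ^ n : SL(2, ℤ)) = rescale h hh (f ∣[k] (T ^ m : SL(2, ℤ))) := by
  ext τ
  rw [slash_T_zpow_apply, rescale, rescale, slash_T_zpow_apply]
  congr 1
  ext
  rw [coe_pos_smul, coe_vadd, coe_vadd, coe_pos_smul, ← hmn]
  push_cast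
  ring

theorem rescale_slash_S (k : ℤ) :
    rescale h hh f ∣[k] S = (h : ℂ) ^ (-k) • rescale h⁻¹ (inv_pos.mpr hh) (f ∣[k] S) := by
  have hh0 : (h : ℂ) ≠ 0 := mod_cast hh.ne'
  ext τ
  have hS : (⟨h, hh⟩ : {x : ℝ // 0 < x}) • S • τ =
      S • (⟨h⁻¹, inv_pos.mpr hh⟩ : {x : ℝ // 0 < x}) • τ := by
    ext
    rw [coe_pos_smul, coe_S_smul, coe_S_smul, coe_pos_smul]
    have := τ.ne_zero
    push_cast
    field_simp
  rw [slash_S_apply, Pi.smul_apply, rescale, rescale, slash_S_apply, coe_pos_smul, hS,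
    smul_eq_mul, mul_zpow, Complex.ofReal_inv, mul_left_comm, ← mul_assoc (_ ^ (-k)), ← mul_zpow,
    mul_inv_cancel₀ hh0, one_zpow, one_mul]

theorem slash_pow_eq_self {k : ℤ} {γ : SL(2, ℤ)} (hf : f ∣[k] γ = f) (n : ℕ) :
    f ∣[k] (γ ^ n) = f := by
  induction n with
  | zero => rw [pow_zero, SlashAction.slash_one]
  | succ n ih => rw [pow_succ, SlashAction.slash_mul, ih, hf]

theorem rescale_slash_T_pow_eq_self {k : ℤ} (hf : f ∣[k] T = f) {m n : ℕ} (hmn : h * n = m) :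
    rescale h hh f ∣[k] (T ^ n : SL(2, ℤ)) = rescale h hh f := by
  rw [← zpow_natCast, rescale_slash_T_zpow (mod_cast hmn), zpow_natCast, slash_pow_eq_self hf]

theorem tendsto_rescale {l : Filter ℂ} (hf : Tendsto f atImInfty l) :
    Tendsto (rescale h hh f) atImInfty l := by
  refine hf.comp (tendsto_comap_iff.mpr ?_)
  have him : Tendsto (fun τ : ℍ ↦ h * τ.im) atImInfty atTop := tendsto_comap.const_mul_atTop hh
  refine him.congr fun τ ↦ ?_
  rw [Function.comp_apply, ← coe_im (_ • τ), coe_pos_smul, Complex.im_ofReal_mul, coe_im]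

theorem mdifferentiable_rescale (hf : MDiff f) : MDiff (rescale h hh f) := by
  rw [UpperHalfPlane.mdifferentiable_iff] at hf ⊢
  have him {z : ℂ} (hz : 0 < z.im) : 0 < (h * z : ℂ).im := by
    rw [Complex.im_ofReal_mul]
    exact mul_pos hh hz
  have hmul : DifferentiableOn ℂ (fun z : ℂ ↦ (h : ℂ) * z) {z | 0 < z.im} := by fun_prop
  refine (hf.comp hmul fun z hz ↦ him hz).congr fun z hz ↦ ?_
  rw [Function.comp_apply, Function.comp_apply, Function.comp_apply, rescale]
  congr 1
  ext
  rw [coe_pos_smul, ofComplex_apply_of_im_pos hz, ofComplex_apply_of_im_pos (him hz)]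

theorem mdifferentiable_div {g : ℍ → ℂ} (hf : MDiff f) (hg : MDiff g) (hg0 : ∀ τ, g τ ≠ 0) :
    MDiff (f / g) := by
  rw [UpperHalfPlane.mdifferentiable_iff] at *
  exact hf.div hg fun z _ ↦ hg0 _

end Rescale

section Eta

open ModularForm (eta discriminant)
open Function.Periodic (qParam)

theorem tendsto_eta_div_qParam :
    Tendsto (fun τ : ℍ ↦ eta τ / qParam 24 τ) atImInfty (𝓝 1) := by
  have hprod : Tendsto (fun q : ℂ ↦ ∏' n : ℕ, (1 - q ^ (n + 1))) (𝓝 0) (𝓝 1) := by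
    have := (ModularForm.differentiableOn_tprod_one_sub_pow.differentiableAt
      (Metric.isOpen_ball.mem_nhds (Metric.mem_ball_self one_pos))).continuousAt.tendsto
    simpa using this
  refine (hprod.comp (qParam_tendsto_atImInfty one_pos)).congr fun τ ↦ ?_
  exact (mul_div_cancel_left₀ _ (Function.Periodic.qParam_ne_zero _)).symm

theorem mdifferentiable_eta : MDiff (fun τ : ℍ ↦ eta τ) := by
  rw [UpperHalfPlane.mdifferentiable_iff]
  have hd : DifferentiableOn ℂ eta {z | 0 < z.im} := fun z hz ↦
    (ModularForm.differentiableAt_eta_of_mem_upperHalfPlaneSet hz).differentiableWithinAt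
  exact hd.congr fun z hz ↦ by rw [Function.comp_apply, ofComplex_apply_of_im_pos hz, coe_mk]

theorem eta_coe_ne_zero (τ : ℍ) : eta τ ≠ 0 :=
  ModularForm.eta_ne_zero τ.im_pos

/-- The eta quotient `η(hτ)^N / η(τ)`, of which `etaLower N` and `etaUpper N` are the cases
`h = 1/N` and `h = N`. -/
noncomputable def etaQuotient (h : ℝ) (hh : 0 < h) (N : ℕ) : ℍ → ℂ :=
  rescale h hh (fun τ ↦ eta τ) ^ N / (fun τ ↦ eta τ : ℍ → ℂ)

section Quotient

variable {h : ℝ} {hh : 0 < h} {N : ℕ}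

theorem etaQuotient_ne_zero (τ : ℍ) : etaQuotient h hh N τ ≠ 0 :=
  div_ne_zero (pow_ne_zero _ (eta_coe_ne_zero _)) (eta_coe_ne_zero τ)

theorem mdifferentiable_etaQuotient : MDiff (etaQuotient h hh N) :=
  mdifferentiable_div ((mdifferentiable_rescale mdifferentiable_eta).pow N) mdifferentiable_eta
    eta_coe_ne_zero

theorem etaQuotient_pow :
    etaQuotient h hh N ^ 24 = rescale h hh discriminant ^ N / discriminant := by
  ext τ
  simp only [etaQuotient, rescale, discriminant, Pi.pow_apply, Pi.div_apply]
  rw [div_pow, pow_right_comm]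

theorem tendsto_etaQuotient_div_exp :
    Tendsto (fun τ : ℍ ↦ etaQuotient h hh N τ /
      Complex.exp (2 * π * Complex.I * (h * N - 1) / 24 * τ)) atImInfty (𝓝 1) := by
  have hlim := ((tendsto_rescale (hh := hh) tendsto_eta_div_qParam).pow N).div
    tendsto_eta_div_qParam one_ne_zero
  rw [one_pow, div_one] at hlim
  refine hlim.congr fun τ ↦ ?_
  have hexp : qParam 24 (h * τ : ℂ) ^ N =
      Complex.exp (2 * π * Complex.I * (h * N - 1) / 24 * τ) * qParam 24 τ := by
    rw [qParam, qParam, ← Complex.exp_nat_mul, ← Complex.exp_add]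
    congr 1
    push_cast
    ring
  simp only [Pi.div_apply, rescale, etaQuotient, Pi.pow_apply, div_pow, coe_pos_smul, hexp]
  have := Function.Periodic.qParam_ne_zero (h := 24) (τ : ℂ)
  field_simp

theorem etaQuotient_pow_slash (γ : SL(2, ℤ)) :
    (etaQuotient h hh N ^ 24) ∣[(12 * (N - 1) : ℤ)] γ =
      (rescale h hh discriminant ∣[(12 : ℤ)] γ) ^ N / discriminant ∣[(12 : ℤ)] γ := by
  rw [etaQuotient_pow, ← pow_slash, ← ModularForm.div_slash_SL2]
  ring_nf

end Quotient

variable (N : ℕ) [NeZero N]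

theorem etaUpper_eq_etaQuotient :
    etaUpper N = etaQuotient N (mod_cast NeZero.pos N) N := by
  ext τ
  simp only [etaUpper, etaQuotient, rescale, Pi.div_apply, Pi.pow_apply, coe_pos_smul,
    Complex.ofReal_natCast]

theorem etaLower_eq_etaQuotient :
    etaLower N = etaQuotient (N : ℝ)⁻¹ (inv_pos.mpr (mod_cast NeZero.pos N)) N := by
  ext τ
  simp only [etaLower, etaQuotient, rescale, Pi.div_apply, Pi.pow_apply, coe_pos_smul,
    Complex.ofReal_inv, Complex.ofReal_natCast, inv_mul_eq_div]

theorem tendsto_etaLower : Tendsto (etaLower N) atImInfty (𝓝 1) := by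
  rw [etaLower_eq_etaQuotient]
  refine (tendsto_etaQuotient_div_exp (hh := inv_pos.mpr (Nat.cast_pos.mpr (NeZero.pos N)))
    (N := N)).congr fun τ ↦ ?_
  have hN : (N : ℂ) ≠ 0 := NeZero.ne _
  rw [Complex.ofReal_inv, Complex.ofReal_natCast, inv_mul_cancel₀ hN, sub_self, mul_zero, zero_div,
    zero_mul, Complex.exp_zero, div_one]

theorem etaUpper_pow_slash_T :
    (etaUpper N ^ 24) ∣[(12 * (N - 1) : ℤ)] T = etaUpper N ^ 24 := by
  rw [etaUpper_eq_etaQuotient, etaQuotient_pow_slash, ModularForm.discriminant_T_invariant,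
    ← pow_one T,
    rescale_slash_T_pow_eq_self (m := N) ModularForm.discriminant_T_invariant (by simp),
    etaQuotient_pow]

theorem etaUpper_pow_slash_S :
    (etaUpper N ^ 24) ∣[(12 * (N - 1) : ℤ)] S = ((N : ℂ) ^ (-12 : ℤ)) ^ N • etaLower N ^ 24 := by
  rw [etaUpper_eq_etaQuotient, etaLower_eq_etaQuotient, etaQuotient_pow_slash,
    rescale_slash_S, ModularForm.discriminant_S_invariant, etaQuotient_pow, smul_pow,
    smul_div_assoc, Complex.ofReal_natCast]

theorem etaLower_pow_slash_T_pow :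
    (etaLower N ^ 24) ∣[(12 * (N - 1) : ℤ)] (T ^ N : SL(2, ℤ)) = etaLower N ^ 24 := by
  have hN : (N : ℝ)⁻¹ * N = (1 : ℕ) := by simp [NeZero.ne]
  rw [etaLower_eq_etaQuotient, etaQuotient_pow_slash,
    slash_pow_eq_self ModularForm.discriminant_T_invariant,
    rescale_slash_T_pow_eq_self ModularForm.discriminant_T_invariant hN, etaQuotient_pow]

theorem isCuspInvariant_etaUpper_pow :
    IsCuspInvariant N (12 * (N - 1)) (etaUpper N ^ 24) where
  slash_T := etaUpper_pow_slash_T N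
  slash_S_slash_T_pow := by
    rw [etaUpper_pow_slash_S, ModularForm.SL_smul_slash, etaLower_pow_slash_T_pow]

end Eta

section EtaExponent

/-- The power `(η(Nτ)^N / η(τ))^e` has weight `w` and a zero of order `1` in `e^{2πiτ/N}` at `i∞`,
that is, `e (N - 1) = 2 w` and `e (N² - 1) / 24 = 1 / N`; both identities are stated without
subtraction. -/
structure IsEtaExponent (N e w : ℕ) : Prop where
  weight : e * N = e + 2 * w
  order : e * N ^ 3 = e * N + 24

namespace IsEtaExponent

variable {N e w : ℕ}

theorem eq_or_eq (h : IsEtaExponent N e w) :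
    (N = 2 ∧ e = 4 ∧ w = 2) ∨ (N = 3 ∧ e = 1 ∧ w = 1) := by
  obtain ⟨hweight, horder⟩ := h
  have he : 1 ≤ e := Nat.one_le_iff_ne_zero.mpr (by rintro rfl; omega)
  have hN : N < 4 := by
    by_contra! hN
    have : 60 ≤ N ^ 3 - N := by
      have : 16 * N ≤ N ^ 3 := by nlinarith [Nat.mul_le_mul hN hN]
      omega
    nlinarith [Nat.sub_add_cancel (Nat.le_self_pow three_ne_zero N)]
  interval_cases N <;> omega

theorem two_le (h : IsEtaExponent N e w) : 2 ≤ N := by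
  obtain h | h := h.eq_or_eq <;> omega

theorem le_three (h : IsEtaExponent N e w) : N ≤ 3 := by
  obtain h | h := h.eq_or_eq <;> omega

theorem ne_zero (h : IsEtaExponent N e w) : N ≠ 0 := by
  have := h.two_le
  omega

theorem even (h : IsEtaExponent N e w) (hN : N = 2) : Even w := by
  obtain ⟨-, -, rfl⟩ | h := h.eq_or_eq
  · exact even_two
  · omega

theorem weight_pos (h : IsEtaExponent N e w) : 0 < w := by
  obtain h | h := h.eq_or_eq <;> omega

theorem tendsto_etaUpper_pow_div_exp (h : IsEtaExponent N e w) :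
    Tendsto (fun τ : ℍ ↦ (etaUpper N ^ e) τ / Complex.exp (2 * π * Complex.I * τ / N))
      atImInfty (𝓝 1) := by
  have : NeZero N := ⟨h.ne_zero⟩
  have hN : (N : ℂ) ≠ 0 := NeZero.ne _
  have horder : (e : ℂ) * N ^ 3 = e * N + 24 := mod_cast h.order
  rw [etaUpper_eq_etaQuotient]
  have hlim := (tendsto_etaQuotient_div_exp (hh := Nat.cast_pos.mpr (NeZero.pos N)) (N := N)).pow e
  rw [one_pow] at hlim
  refine hlim.congr fun τ ↦ ?_
  rw [div_pow, ← Complex.exp_nat_mul, Pi.pow_apply]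
  congr 2
  rw [Complex.ofReal_natCast]
  field_simp
  linear_combination (τ : ℂ) * horder

theorem tendsto_etaUpper_pow (h : IsEtaExponent N e w) :
    Tendsto (etaUpper N ^ e) atImInfty (𝓝 0) := by
  have hN : (0 : ℝ) < N := mod_cast Nat.pos_of_ne_zero h.ne_zero
  rw [← one_mul (0 : ℂ)]
  refine (h.tendsto_etaUpper_pow_div_exp.mul (qParam_tendsto_atImInfty hN)).congr fun τ ↦ ?_
  rw [Function.Periodic.qParam, Complex.ofReal_natCast, div_mul_cancel₀ _ (Complex.exp_ne_zero _)]

theorem isBigO_exp_etaUpper_pow (h : IsEtaExponent N e w) :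
    (fun τ : ℍ ↦ Real.exp (-2 * π * τ.im / N)) =O[atImInfty] (etaUpper N ^ e) := by
  have hexp : (fun τ : ℍ ↦ Complex.exp (2 * π * Complex.I * τ / N)) =O[atImInfty]
      (etaUpper N ^ e) :=
    (Asymptotics.isEquivalent_of_tendsto_one h.tendsto_etaUpper_pow_div_exp).isBigO_symm
  refine hexp.norm_left.congr_left fun τ ↦ ?_
  rw [Complex.norm_exp]
  congr 1
  simp

end IsEtaExponent

end EtaExponent

section Comparison

variable {N k l : ℕ} {f θ : ℍ → ℂ}

theorem div_mem_modularForms_Gamma [NeZero N] (hf : f ∈ modularForms Γ(N) (k + l))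
    (hθ : θ ∈ modularForms Γ(N) l) (hθ0 : ∀ τ, θ τ ≠ 0)
    (hO : ∀ γ : SL(2, ℤ), (f ∣[((k + l : ℕ) : ℤ)] γ) =O[atImInfty] (θ ∣[(l : ℤ)] γ)) :
    f / θ ∈ modularForms Γ(N) k := by
  rw [mem_modularForms_Gamma_iff] at hf hθ ⊢
  have hdiv (γ : SL(2, ℤ)) :
      (f / θ) ∣[(k : ℤ)] γ = f ∣[((k + l : ℕ) : ℤ)] γ / θ ∣[(l : ℤ)] γ := by
    rw [← ModularForm.div_slash_SL2, Nat.cast_add, add_sub_cancel_right]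
  refine ⟨mdifferentiable_div hf.1 hθ.1 hθ0, fun γ hγ ↦ ?_, fun γ ↦ ?_⟩
  · rw [hdiv, hf.2.1 γ hγ, hθ.2.1 γ hγ]
  · have hO' := (hO γ).mul (Asymptotics.isBigO_refl (θ ∣[(l : ℤ)] γ)⁻¹ atImInfty)
    rw [hdiv, div_eq_mul_inv]
    refine hO'.trans (Asymptotics.isBigO_of_le _ fun τ ↦ ?_)
    simpa [div_eq_mul_inv] using div_self_le_one ‖(θ ∣[(l : ℤ)] γ) τ‖

theorem isBigO_pow_slash {n : ℕ} (hN2 : 2 ≤ N) (hN3 : N ≤ 3) {l : ℤ} (hθ : IsCuspInvariant N l θ)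
    (hexp : ((fun τ : ℍ ↦ Real.exp (-2 * π * τ.im / N)) ^ n) =O[atImInfty] θ)
    (hS : (1 : ℍ → ℝ) =O[atImInfty] (θ ∣[l] S)) (hf : f ∈ modularForms Γ(N) k)
    (h0 : Tendsto f atImInfty (𝓝 0)) (γ : SL(2, ℤ)) :
    ((f ∣[(k : ℤ)] γ) ^ n) =O[atImInfty] (θ ∣[l] γ) := by
  have : NeZero N := ⟨by omega⟩
  by_cases hγ : (N : ℤ) ∣ γ 1 0
  · obtain ⟨ε, hε, hslash⟩ := hθ.exists_slash_eq_smul hN2 hN3 hγ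
    rw [hslash]
    refine (((isBigO_exp_of_mem_modularForms_Gamma (slash_mem_modularForms_Gamma hf γ)
      (tendsto_slash_zero_of_dvd hN2 hN3 hf h0 hγ)).pow n).trans hexp).trans ?_
    exact (Asymptotics.isBigO_const_smul_right hε).mpr (Asymptotics.isBigO_refl _ _)
  · obtain ⟨ε, hε, j, hslash⟩ := hθ.exists_slash_eq_smul_slash_S hN2 hN3 hγ
    have hST : (1 : ℍ → ℝ) =O[atImInfty] ((θ ∣[l] S) ∣[l] (T ^ j : SL(2, ℤ))) :=
      (hS.comp_tendsto (tendsto_vadd_atImInfty j)).congr_right fun τ ↦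
        (slash_T_zpow_apply _ l j τ).symm
    have hbdd : ((f ∣[(k : ℤ)] γ) ^ n) =O[atImInfty] (1 : ℍ → ℝ) := by
      have := ((mem_modularForms_Gamma_iff.mp hf).2.2 γ).pow n
      exact this.congr_right fun _ ↦ one_pow n
    rw [hslash]
    exact (hbdd.trans hST).trans
      ((Asymptotics.isBigO_const_smul_right hε).mpr (Asymptotics.isBigO_refl _ _))

end Comparison

theorem exists_eq_smul_of_pow_eq_smul_pow {X : Type*} [TopologicalSpace X] [PreconnectedSpace X]
    [Nonempty X] {f g : X → ℂ} (hf : Continuous f) (hg : Continuous g) (hg0 : ∀ x, g x ≠ 0) {n : ℕ}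
    (hn : n ≠ 0) {c : ℂ} (h : f ^ n = c • g ^ n) : ∃ d : ℂ, f = d • g := by
  have hfinite : {z : ℂ | z ^ n = c}.Finite :=
    (Polynomial.nthRoots n c).toFinset.finite_toSet.subset fun z hz ↦ by
      simpa [Polynomial.mem_nthRoots hn.bot_lt] using hz
  have hroots : Set.MapsTo (f / g) Set.univ {z : ℂ | z ^ n = c} := fun x _ ↦ by
    rw [Set.mem_ofPred_eq, Pi.div_apply, div_pow, div_eq_iff (pow_ne_zero n (hg0 x))]
    exact congrFun h x
  obtain ⟨x₀⟩ := ‹Nonempty X›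
  refine ⟨(f / g) x₀, funext fun x ↦ ?_⟩
  rw [Pi.smul_apply, smul_eq_mul, ← isPreconnected_univ.constant_of_mapsTo hfinite.isDiscrete
    (hf.div hg hg0).continuousOn hroots (Set.mem_univ x) (Set.mem_univ x₀), Pi.div_apply,
    div_mul_cancel₀ _ (hg0 x)]

namespace IsEtaExponent

variable {N e w k : ℕ} {f : ℍ → ℂ}

theorem etaUpper_pow_ne_zero (h : IsEtaExponent N e w) (τ : ℍ) : (etaUpper N ^ e) τ ≠ 0 := by
  have : NeZero N := ⟨h.ne_zero⟩
  rw [etaUpper_eq_etaQuotient]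
  exact pow_ne_zero _ (etaQuotient_ne_zero τ)

theorem mdifferentiable_etaUpper_pow (h : IsEtaExponent N e w) : MDiff (etaUpper N ^ e) := by
  have : NeZero N := ⟨h.ne_zero⟩
  rw [etaUpper_eq_etaQuotient]
  exact mdifferentiable_etaQuotient.pow e

theorem isCuspInvariant_etaUpper_pow (h : IsEtaExponent N e w) :
    IsCuspInvariant N (24 * w) ((etaUpper N ^ e) ^ 24) := by
  have : NeZero N := ⟨h.ne_zero⟩
  have hweight : (e : ℤ) * N = e + 2 * w := mod_cast h.weight
  have := (_root_.isCuspInvariant_etaUpper_pow N).pow e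
  rwa [pow_right_comm, show (e : ℤ) * (12 * (N - 1)) = 24 * w by linear_combination 12 * hweight]
    at this

theorem exists_etaUpper_pow_slash_S (h : IsEtaExponent N e w) :
    ∃ c : ℂ, c ≠ 0 ∧
      (((etaUpper N ^ e) ^ 24) ∣[(24 * w : ℤ)] S) = c • (etaLower N ^ e) ^ 24 := by
  have : NeZero N := ⟨h.ne_zero⟩
  have hN : (N : ℂ) ≠ 0 := NeZero.ne _
  have hweight : (e : ℤ) * N = e + 2 * w := mod_cast h.weight
  refine ⟨(((N : ℂ) ^ (-12 : ℤ)) ^ N) ^ e, pow_ne_zero _ (pow_ne_zero _ (zpow_ne_zero _ hN)), ?_⟩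
  rw [pow_right_comm, show (24 * w : ℤ) = e * (12 * (N - 1)) by linear_combination -12 * hweight,
    pow_slash, etaUpper_pow_slash_S, smul_pow, pow_right_comm (etaLower N)]

theorem tendsto_etaLower_pow (h : IsEtaExponent N e w) :
    Tendsto (etaLower N ^ e) atImInfty (𝓝 1) := by
  have : NeZero N := ⟨h.ne_zero⟩
  simpa using! (tendsto_etaLower N).pow e

theorem isBigO_pow_slash_etaUpper_pow (h : IsEtaExponent N e w) (hf : f ∈ modularForms Γ(N) k)
    (h0 : Tendsto f atImInfty (𝓝 0)) (γ : SL(2, ℤ)) :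
    ((f ∣[(k : ℤ)] γ) ^ 24) =O[atImInfty] (((etaUpper N ^ e) ^ 24) ∣[(24 * w : ℤ)] γ) := by
  obtain ⟨c, hc, hS⟩ := h.exists_etaUpper_pow_slash_S
  refine isBigO_pow_slash h.two_le h.le_three h.isCuspInvariant_etaUpper_pow
    (h.isBigO_exp_etaUpper_pow.pow 24) ?_ hf h0 γ
  rw [hS]
  refine Asymptotics.IsBigO.trans ?_
    ((Asymptotics.isBigO_const_smul_right hc).mpr (Asymptotics.isBigO_refl _ _))
  have hlim : Tendsto ((etaLower N ^ e) ^ 24) atImInfty (𝓝 1) := by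
    simpa using! h.tendsto_etaLower_pow.pow 24
  exact (Asymptotics.isBigO_const_const (1 : ℝ) (one_ne_zero (α := ℂ)) _).trans
    ((Asymptotics.isEquivalent_const_iff_tendsto one_ne_zero).mpr hlim).isBigO_symm

theorem etaUpper_pow_pow_mem (h : IsEtaExponent N e w) :
    (etaUpper N ^ e) ^ 24 ∈ modularForms Γ(N) (24 * w) := by
  obtain ⟨c, -, hS⟩ := h.exists_etaUpper_pow_slash_S
  refine IsCuspInvariant.mem_modularForms_Gamma ?_ h.two_le h.le_three
    (fun _ ↦ (even_two_mul 12).mul_right w) (h.mdifferentiable_etaUpper_pow.pow 24)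
    ((h.tendsto_etaUpper_pow.pow 24).isBigO_one ℝ) ?_
  · exact_mod_cast h.isCuspInvariant_etaUpper_pow
  · push_cast
    rw [hS]
    exact ((h.tendsto_etaLower_pow.pow 24).isBigO_one ℝ).const_smul_left c

end IsEtaExponent

theorem eq_zero_of_mem_modularForms_Gamma_two {k : ℕ} (hk : ¬ Even k) {f : ℍ → ℂ}
    (hf : f ∈ modularForms Γ(2) k) : f = 0 := by
  have hneg := (mem_modularForms_Gamma_iff.mp hf).2.1 (-1) (by
    rw [CongruenceSubgroup.Gamma_mem]
    decide)
  rw [slash_neg, SlashAction.slash_one, zpow_natCast, (Nat.not_even_iff_odd.mp hk).neg_one_pow,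
    neg_one_smul] at hneg
  exact self_eq_neg.mp hneg.symm

theorem exists_eq_const_of_mem_modularForms_Gamma_zero {N : ℕ} [NeZero N] {f : ℍ → ℂ}
    (hf : f ∈ modularForms Γ(N) 0) : ∃ c : ℂ, f = Function.const ℍ c := by
  obtain ⟨g, rfl⟩ := hf
  exact ModularForm.eq_const_of_weight_zero (ModularForm.mcast Nat.cast_zero g)

namespace IsEtaExponent

variable {N e w k : ℕ} {f y : ℍ → ℂ}

theorem exists_eq_smul_etaUpper_pow (h : IsEtaExponent N e w) (hy : y ∈ modularForms Γ(N) w)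
    (h0 : Tendsto y atImInfty (𝓝 0)) : ∃ c : ℂ, y = c • etaUpper N ^ e := by
  have : NeZero N := ⟨h.ne_zero⟩
  have hy24 : y ^ 24 ∈ modularForms Γ(N) (0 + 24 * w) := by
    simpa using SetLike.pow_mem_graded 24 hy
  have hquot : y ^ 24 / (etaUpper N ^ e) ^ 24 ∈ modularForms Γ(N) 0 := by
    refine div_mem_modularForms_Gamma hy24 h.etaUpper_pow_pow_mem
      (fun τ ↦ pow_ne_zero _ (h.etaUpper_pow_ne_zero τ)) fun γ ↦ ?_
    have hO := h.isBigO_pow_slash_etaUpper_pow hy h0 γ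
    rw [← pow_slash] at hO
    simpa using! hO
  obtain ⟨c, hc⟩ := exists_eq_const_of_mem_modularForms_Gamma_zero hquot
  refine exists_eq_smul_of_pow_eq_smul_pow (mem_modularForms_Gamma_iff.mp hy).1.continuous
    h.mdifferentiable_etaUpper_pow.continuous h.etaUpper_pow_ne_zero (n := 24) (by norm_num)
    (c := c) (funext fun τ ↦ ?_)
  exact (div_eq_iff (pow_ne_zero 24 (h.etaUpper_pow_ne_zero τ))).mp (congrFun hc τ)

theorem etaUpper_pow_mem (h : IsEtaExponent N e w) (hy : y ∈ modularForms Γ(N) w)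
    (h0 : Tendsto y atImInfty (𝓝 0)) (hy0 : y ≠ 0) : etaUpper N ^ e ∈ modularForms Γ(N) w := by
  obtain ⟨c, rfl⟩ := h.exists_eq_smul_etaUpper_pow hy h0
  exact ((modularForms Γ(N) w).smul_mem_iff (left_ne_zero_of_smul hy0)).mp hy

theorem etaLower_pow_mem (h : IsEtaExponent N e w)
    (hmem : etaUpper N ^ e ∈ modularForms Γ(N) w) : etaLower N ^ e ∈ modularForms Γ(N) w := by
  have : NeZero N := ⟨h.ne_zero⟩
  have hd : MDiff (etaLower N ^ e) := by
    rw [etaLower_eq_etaQuotient]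
    exact mdifferentiable_etaQuotient.pow e
  have hslash := slash_mem_modularForms_Gamma hmem S
  have hne (τ : ℍ) : ((etaUpper N ^ e) ∣[(w : ℤ)] S) τ ≠ 0 := by
    rw [slash_S_apply]
    exact mul_ne_zero (h.etaUpper_pow_ne_zero _) (zpow_ne_zero _ τ.ne_zero)
  obtain ⟨c, hc, hS⟩ := h.exists_etaUpper_pow_slash_S
  obtain ⟨d, hsmul⟩ := exists_eq_smul_of_pow_eq_smul_pow hd.continuous
    (mem_modularForms_Gamma_iff.mp hslash).1.continuous hne (n := 24) (by norm_num) (c := c⁻¹) (by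
      rw [← pow_slash, Nat.cast_ofNat, hS, inv_smul_smul₀ hc])
  rw [hsmul]
  exact (modularForms Γ(N) w).smul_mem d hslash

theorem exists_eq_mul_etaUpper_pow (h : IsEtaExponent N e w)
    (hmem : etaUpper N ^ e ∈ modularForms Γ(N) w) (hf : f ∈ modularForms Γ(N) (k + w))
    (h0 : Tendsto f atImInfty (𝓝 0)) : ∃ g ∈ modularForms Γ(N) k, f = g * etaUpper N ^ e := by
  have : NeZero N := ⟨h.ne_zero⟩
  refine ⟨f / etaUpper N ^ e, div_mem_modularForms_Gamma hf hmem h.etaUpper_pow_ne_zero fun γ ↦ ?_,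
    funext fun τ ↦ (div_mul_cancel₀ _ (h.etaUpper_pow_ne_zero τ)).symm⟩
  have hO := h.isBigO_pow_slash_etaUpper_pow hf h0 γ
  rw [show (24 * w : ℤ) = (24 : ℕ) * w by norm_num, pow_slash] at hO
  exact hO.of_pow (by norm_num)

theorem eq_zero_of_not_dvd (h : IsEtaExponent N e w) (hk : ¬ w ∣ k)
    (hf : f ∈ modularForms Γ(N) k) : f = 0 := by
  obtain ⟨rfl, -, rfl⟩ | ⟨-, -, rfl⟩ := h.eq_or_eq
  · exact eq_zero_of_mem_modularForms_Gamma_two (mt even_iff_two_dvd.mp hk) hf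
  · exact absurd (one_dvd k) hk

theorem isPolynomialRingIn (h : IsEtaExponent N e w) {x y : modularForms Γ(N) w}
    (hx : Tendsto (x : ℍ → ℂ) atImInfty (𝓝 1)) (hy : Tendsto (y : ℍ → ℂ) atImInfty (𝓝 0))
    (hy0 : y ≠ 0) : IsPolynomialRingIn (ModularFormRing.ofForm x) (ModularFormRing.ofForm y) := by
  have : NeZero N := ⟨h.ne_zero⟩
  have hy0' : (y : ℍ → ℂ) ≠ 0 := mt (ZeroMemClass.coe_eq_zero).mp hy0
  have hmem := h.etaUpper_pow_mem y.2 hy hy0'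
  obtain ⟨c, hc⟩ := h.exists_eq_smul_etaUpper_pow y.2 hy
  have hc0 : c ≠ 0 := by
    rintro rfl
    exact hy0' (hc.trans (zero_smul _ _))
  have hdiv : ModularFormRing.HasDivision x y :=
    { const := fun g ↦ exists_eq_const_of_mem_modularForms_Gamma_zero g.2
      eq_zero := fun k hk g ↦ Subtype.ext (h.eq_zero_of_not_dvd hk g.2)
      lim := fun k g ↦ exists_tendsto_of_mem_modularForms_Gamma g.2
      div := fun k g hg ↦ by
        obtain ⟨q, hq, hgq⟩ := h.exists_eq_mul_etaUpper_pow hmem g.2 hg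
        refine ⟨⟨c⁻¹ • q, (modularForms Γ(N) k).smul_mem _ hq⟩, ?_⟩
        rw [hgq, hc, smul_mul_smul_comm, inv_mul_cancel₀ hc0, one_smul]
      tendsto_left := hx }
  refine hdiv.isPolynomialRingIn h.weight_pos hy fun τ ↦ ?_
  rw [hc]
  exact mul_ne_zero hc0 (h.etaUpper_pow_ne_zero τ)

end IsEtaExponent

section Fricke

/-- A holomorphic function `E` on the upper half plane with `E(τ + 1) = E(τ)` and `E(i∞) = 1` that
the Fricke involution `τ ↦ -1/(Nτ)`, where `N = 1/h`, multiplies by a constant in weight `w`; the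
last condition is stated as `E(-1/τ) τ^{-w} = κ E(hτ)`. -/
structure IsFrickeForm (h : ℝ) (hh : 0 < h) (w : ℕ) (κ : ℂ) (E : ℍ → ℂ) : Prop where
  mdifferentiable : MDiff E
  tendsto : Tendsto E atImInfty (𝓝 1)
  slash_T : E ∣[(w : ℤ)] T = E
  slash_S : E ∣[(w : ℤ)] S = κ • rescale h hh E

theorem eq_one_of_rescale_eq_self {h : ℝ} {hh : 0 < h} {E : ℍ → ℂ} (h1 : 1 < h)
    (hE : Tendsto E atImInfty (𝓝 1)) (heq : rescale h hh E = E) : E = 1 := by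
  funext τ
  let f : ℍ → ℍ := fun z ↦ (⟨h, hh⟩ : {x : ℝ // 0 < x}) • z
  have hvalue (k : ℕ) : E (f^[k] τ) = E τ := by
    induction k with
    | zero => rfl
    | succ k ih => rw [Function.iterate_succ_apply', ← ih, ← congrFun heq (f^[k] τ), rescale]
  have him (k : ℕ) : (f^[k] τ).im = h ^ k * τ.im := by
    induction k with
    | zero => rw [pow_zero, one_mul, Function.iterate_zero, id]
    | succ k ih =>
      rw [Function.iterate_succ_apply', pow_succ', mul_assoc, ← ih, ← coe_im, coe_pos_smul,
        Complex.im_ofReal_mul, coe_im]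
  have hlim : Tendsto (fun k ↦ f^[k] τ) atTop atImInfty :=
    tendsto_comap_iff.mpr
      (((tendsto_pow_atTop_atTop_of_one_lt h1).atTop_mul_const τ.im_pos).congr fun k ↦ (him k).symm)
  exact tendsto_nhds_unique (tendsto_const_nhds.congr fun k ↦ (hvalue k).symm) (hE.comp hlim)

theorem one_slash_S_ne_smul_one {w : ℕ} (hw : w ≠ 0) (κ : ℂ) :
    (1 : ℍ → ℂ) ∣[(w : ℤ)] S ≠ κ • 1 := by
  intro heq
  have hvalue (τ : ℍ) : ((τ : ℂ) ^ w)⁻¹ = κ := by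
    simpa [slash_S_apply] using congrFun heq τ
  have htwo := (hvalue ((⟨2, two_pos⟩ : {x : ℝ // 0 < x}) • UpperHalfPlane.I)).trans
    (hvalue UpperHalfPlane.I).symm
  rw [coe_pos_smul, mul_pow, inv_inj, mul_eq_right₀ (pow_ne_zero w UpperHalfPlane.I.ne_zero)]
    at htwo
  exact (one_lt_pow₀ (one_lt_two : (1 : ℝ) < 2) hw).ne' (mod_cast htwo)

namespace IsFrickeForm

variable {h : ℝ} {hh : 0 < h} {N e w : ℕ} {κ : ℂ} {E : ℍ → ℂ}

theorem isCuspInvariant (hE : IsFrickeForm h hh w κ E) (hN : h * N = 1) :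
    IsCuspInvariant N w E where
  slash_T := hE.slash_T
  slash_S_slash_T_pow := by
    rw [hE.slash_S, ModularForm.SL_smul_slash,
      rescale_slash_T_pow_eq_self hE.slash_T (m := 1) (mod_cast hN)]

theorem ne_rescale (hE : IsFrickeForm h hh w κ E) (h1 : h < 1) (hw : w ≠ 0) :
    E ≠ rescale h hh E := by
  intro heq
  have hinv : rescale h⁻¹ (inv_pos.mpr hh) E = E :=
    (congrArg (rescale h⁻¹ _) heq).trans (rescale_rescale_eq_self (inv_mul_cancel₀ hh.ne'))
  have hone := eq_one_of_rescale_eq_self ((one_lt_inv₀ hh).mpr h1) hE.tendsto hinv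
  have hslash := hE.slash_S
  rw [← heq, hone] at hslash
  exact one_slash_S_ne_smul_one hw κ hslash

theorem mem_modularForms_Gamma (hE : IsFrickeForm h hh w κ E) (hN : h * N = 1)
    (hη : IsEtaExponent N e w) : E ∈ modularForms Γ(N) w := by
  refine (hE.isCuspInvariant hN).mem_modularForms_Gamma hη.two_le hη.le_three hη.even
    hE.mdifferentiable (hE.tendsto.isBigO_one ℝ) ?_
  rw [hE.slash_S]
  exact ((tendsto_rescale hE.tendsto).isBigO_one ℝ).const_smul_left κ

theorem exists_isPolynomialRingIn (hE : IsFrickeForm h hh w κ E) (hκ : κ ≠ 0) (hN : h * N = 1)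
    (hη : IsEtaExponent N e w) :
    ∃ e₁ e₂ f₁ f₂ : modularForms Γ(N) w,
      (e₁ : ℍ → ℂ) = rescale h hh E ∧
      (e₂ : ℍ → ℂ) = E ∧
      (f₁ : ℍ → ℂ) = etaLower N ^ e ∧
      (f₂ : ℍ → ℂ) = etaUpper N ^ e ∧
      IsPolynomialRingIn (ModularFormRing.ofForm e₁) (ModularFormRing.ofForm e₂) ∧
      IsPolynomialRingIn (ModularFormRing.ofForm f₁) (ModularFormRing.ofForm f₂) := by
  have : NeZero N := ⟨hη.ne_zero⟩
  have h1 : h < 1 := by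
    have : (2 : ℝ) ≤ N := mod_cast hη.two_le
    nlinarith
  have hmem := hE.mem_modularForms_Gamma hN hη
  have hmem' : rescale h hh E ∈ modularForms Γ(N) w := by
    have := slash_mem_modularForms_Gamma hmem S
    rwa [hE.slash_S, Submodule.smul_mem_iff _ hκ] at this
  have hlim := tendsto_rescale (hh := hh) hE.tendsto
  have hdiff : Tendsto (rescale h hh E - E) atImInfty (𝓝 0) := by
    simpa using! hlim.sub hE.tendsto
  have hdiff0 : rescale h hh E - E ≠ 0 :=
    sub_ne_zero.mpr (hE.ne_rescale h1 hη.weight_pos.ne').symm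
  have hupper := hη.etaUpper_pow_mem (sub_mem hmem' hmem) hdiff hdiff0
  refine ⟨⟨_, hmem'⟩, ⟨_, hmem⟩, ⟨_, hη.etaLower_pow_mem hupper⟩, ⟨_, hupper⟩, rfl, rfl, rfl, rfl,
    ?_, ?_⟩
  · have := (hη.isPolynomialRingIn (x := ⟨_, hmem'⟩) (y := ⟨_, hmem'⟩ - ⟨_, hmem⟩) hlim hdiff
      (mt (congrArg Subtype.val) hdiff0)).sub_right
    rwa [← ModularFormRing.ofForm_sub, sub_sub_cancel] at this
  · exact hη.isPolynomialRingIn hη.tendsto_etaLower_pow hη.tendsto_etaUpper_pow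
      (mt (congrArg Subtype.val) (funext_iff.not.mpr fun h0 ↦
        hη.etaUpper_pow_ne_zero UpperHalfPlane.I (h0 _)))

end IsFrickeForm

end Fricke

section QSeries

theorem differentiableOn_tsum_mul_pow {c : ℕ → ℂ}
    (hc : ∀ q : ℂ, ‖q‖ < 1 → Summable fun n ↦ ‖c n * q ^ n‖) :
    DifferentiableOn ℂ (fun q : ℂ ↦ ∑' n, c n * q ^ n) (Metric.ball 0 1) := by
  have hradius : 1 ≤ (FormalMultilinearSeries.ofScalars ℂ c).radius := by
    refine le_of_forall_lt_imp_le_of_dense fun r hr ↦ ?_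
    lift r to NNReal using hr.ne_top
    refine FormalMultilinearSeries.le_radius_of_summable _ ?_
    simpa using hc r (by simpa using hr)
  have hd := (((FormalMultilinearSeries.ofScalars ℂ c).hasFPowerSeriesOnBall
    (one_pos.trans_le hradius)).mono one_pos hradius).differentiableOn
  rw [← ENNReal.coe_one, Metric.eball_coe, NNReal.coe_one] at hd
  refine hd.congr fun q _ ↦ ?_
  simp [FormalMultilinearSeries.sum, mul_comm]

theorem summable_norm_mul_pow_of_le {b : ℕ → ℂ} {k : ℕ} (hb : ∀ n, ‖b n‖ ≤ n ^ k) {q : ℂ}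
    (hq : ‖q‖ < 1) : Summable fun n ↦ ‖b n * q ^ n‖ := by
  refine (summable_norm_pow_mul_geometric_of_norm_lt_one k hq).of_nonneg_of_le
    (fun n ↦ norm_nonneg _) fun n ↦ ?_
  rw [norm_mul, norm_mul, norm_pow (n : ℂ), Complex.norm_natCast]
  exact mul_le_mul_of_nonneg_right (hb n) (norm_nonneg _)

/-- The function `∑_{n ≥ 1} b(n) qⁿ` with `q = e^{2πiτ}`. The sum is indexed by `ℕ+`, so the
value `b 0` is irrelevant. -/
noncomputable def qSeries (b : ℕ → ℂ) (τ : ℍ) : ℂ :=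
  ∑' n : ℕ+, b n * Complex.exp (2 * π * Complex.I * τ) ^ (n : ℕ)

theorem qSeries_slash_T (b : ℕ → ℂ) (k : ℤ) : qSeries b ∣[k] T = qSeries b := by
  ext τ
  have hexp : Complex.exp (2 * π * Complex.I * ((1 : ℝ) +ᵥ τ : ℍ)) =
      Complex.exp (2 * π * Complex.I * τ) := by
    rw [coe_vadd, mul_add, Complex.exp_add, Complex.ofReal_one, mul_one, Complex.exp_two_pi_mul_I,
      one_mul]
  rw [slash_T_apply, qSeries, qSeries, hexp]

variable {b : ℕ → ℂ} {k : ℕ}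

theorem qSeries_eq_tsum_nat (hb : ∀ n, ‖b n‖ ≤ n ^ k) (h0 : b 0 = 0) (τ : ℍ) :
    qSeries b τ = ∑' n : ℕ, b n * Complex.exp (2 * π * Complex.I * τ) ^ n := by
  rw [qSeries, ← tsum_zero_pnat_eq_tsum_nat
    (summable_norm_mul_pow_of_le hb (norm_exp_two_pi_I_lt_one τ)).of_norm, h0, zero_mul, zero_add]

theorem mdifferentiable_qSeries (hb : ∀ n, ‖b n‖ ≤ n ^ k) (h0 : b 0 = 0) : MDiff (qSeries b) := by
  rw [UpperHalfPlane.mdifferentiable_iff]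
  have hseries := differentiableOn_tsum_mul_pow fun q hq ↦ summable_norm_mul_pow_of_le hb hq
  have hexp : DifferentiableOn ℂ (fun z : ℂ ↦ Complex.exp (2 * π * Complex.I * z))
      {z | 0 < z.im} := by fun_prop
  refine (hseries.comp hexp fun z hz ↦ ?_).congr fun z hz ↦ ?_
  · simpa using norm_exp_two_pi_I_lt_one ⟨z, hz⟩
  · rw [Function.comp_apply, qSeries_eq_tsum_nat hb h0, ofComplex_apply_of_im_pos hz,
      Function.comp_apply]

theorem tendsto_qSeries (hb : ∀ n, ‖b n‖ ≤ n ^ k) (h0 : b 0 = 0) :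
    Tendsto (qSeries b) atImInfty (𝓝 0) := by
  have hcont := ((differentiableOn_tsum_mul_pow fun q hq ↦
    summable_norm_mul_pow_of_le hb hq).differentiableAt
    (Metric.isOpen_ball.mem_nhds (Metric.mem_ball_self one_pos))).continuousAt.tendsto
  have hzero : ∑' n : ℕ, b n * 0 ^ n = 0 := by
    rw [tsum_eq_single 0 fun n hn ↦ by rw [zero_pow hn, mul_zero], h0, zero_mul]
  rw [hzero] at hcont
  refine (hcont.comp (qParam_tendsto_atImInfty one_pos)).congr fun τ ↦ ?_
  rw [qSeries_eq_tsum_nat hb h0, Function.comp_apply, Function.Periodic.qParam, Complex.ofReal_one,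
    div_one]

end QSeries

section LevelTwo

open EisensteinSeries (E2)
open scoped ArithmeticFunction.sigma

theorem E2_eq_qSeries : E2 = fun τ ↦ 1 - 24 * qSeries (fun n ↦ (σ 1 n : ℂ)) τ := by
  ext τ
  rw [EisensteinSeries.E2_eq_tsum_cexp]
  rfl

theorem tendsto_E2 : Tendsto E2 atImInfty (𝓝 1) := by
  have hbound (n : ℕ) : ‖(σ 1 n : ℂ)‖ ≤ (n : ℝ) ^ 2 := by
    rw [Complex.norm_natCast]
    exact_mod_cast ArithmeticFunction.sigma_le_pow_succ 1 n
  rw [E2_eq_qSeries]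
  simpa using ((tendsto_qSeries hbound (by simp)).const_mul 24).const_sub 1

theorem E2_slash_T : E2 ∣[(2 : ℤ)] T = E2 := by
  rw [EisensteinSeries.E2_slash_action, EisensteinSeries.D2_T, smul_zero, sub_zero]

theorem exists_E2_slash_S_eq_add_smul_inv :
    ∃ c : ℂ, E2 ∣[(2 : ℤ)] S = E2 + c • fun τ : ℍ ↦ (τ : ℂ)⁻¹ := by
  refine ⟨-(1 / (2 * riemannZeta 2) * (2 * π * Complex.I)), ?_⟩
  rw [EisensteinSeries.E2_slash_action]
  ext τ
  simp only [Pi.sub_apply, Pi.add_apply, Pi.smul_apply, EisensteinSeries.D2_S, smul_eq_mul]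
  ring

theorem eisensteinTwoTwo_eq : eisensteinTwoTwo = (2 : ℂ) • rescale 2 two_pos E2 - E2 :=
  rfl

theorem eisensteinTwoTwo_slash_T : eisensteinTwoTwo ∣[(2 : ℤ)] T = eisensteinTwoTwo := by
  have h : rescale 2 two_pos E2 ∣[(2 : ℤ)] T = rescale 2 two_pos E2 := by
    simpa only [pow_one] using rescale_slash_T_pow_eq_self (m := 2) (n := 1) E2_slash_T (by simp)
  rw [eisensteinTwoTwo_eq, sub_eq_add_neg, SlashAction.add_slash, SlashAction.neg_slash,
    ModularForm.SL_smul_slash, h, E2_slash_T]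

theorem eisensteinTwoTwo_slash_S :
    eisensteinTwoTwo ∣[(2 : ℤ)] S =
      (-(1 / 2) : ℂ) • rescale (1 / 2) one_half_pos eisensteinTwoTwo := by
  obtain ⟨c, hc⟩ := exists_E2_slash_S_eq_add_smul_inv
  have hinv : rescale (1 / 2) one_half_pos (rescale 2 two_pos E2) = E2 :=
    rescale_rescale_eq_self (by norm_num)
  rw [eisensteinTwoTwo_eq, sub_eq_add_neg, SlashAction.add_slash, SlashAction.neg_slash,
    ModularForm.SL_smul_slash, rescale_slash_S, hc]
  ext τ
  have hinvτ := congrFun hinv τ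
  simp only [← one_div, rescale, Pi.add_apply, Pi.neg_apply, Pi.smul_apply, smul_eq_mul,
    coe_pos_smul] at hinvτ ⊢
  rw [hinvτ]
  push_cast
  ring

theorem isFrickeForm_eisensteinTwoTwo :
    IsFrickeForm (1 / 2) one_half_pos 2 (-(1 / 2)) eisensteinTwoTwo where
  mdifferentiable := (mdifferentiable_const.mul
    (mdifferentiable_rescale E2_mdifferentiable)).sub E2_mdifferentiable
  tendsto := by
    convert! ((tendsto_rescale (hh := two_pos) tendsto_E2).const_mul 2).sub tendsto_E2 using 2
    norm_num
  slash_T := eisensteinTwoTwo_slash_T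
  slash_S := eisensteinTwoTwo_slash_S

end LevelTwo

section Zeta

open Bornology (cobounded)
open Complex (cot integerComplement)

/-- The average over `±w` of the regularised summand `1 / (z - w) + 1 / w + z / w ^ 2` of the
Weierstrass zeta function. At `w = 0` division by zero turns it into the principal part `1 / z`. -/
noncomputable def zetaTerm (z w : ℂ) : ℂ := z / (z ^ 2 - w ^ 2) + z / w ^ 2

/-- The Weierstrass zeta function of the lattice `ℤ τ + ℤ`; the summands have been averaged over
`±w`, which does not change the sum. -/
noncomputable def latticeZeta (z : ℂ) (τ : ℍ) : ℂ :=
  ∑' x : Fin 2 → ℤ, zetaTerm z (x 0 * τ + x 1)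

theorem zetaTerm_div_mul (z w c : ℂ) (hc : c ≠ 0) :
    zetaTerm (z / c) (w / c) = c * zetaTerm z w := by
  have h (a : ℂ) : z / c / (a / c ^ 2) = c * (z / a) := by
    rcases eq_or_ne a 0 with rfl | ha
    · rw [zero_div, div_zero, div_zero, mul_zero]
    · field_simp
  rw [zetaTerm, zetaTerm, div_pow, div_pow, ← sub_div, h, h, mul_add]

theorem isBigO_zetaTerm (z : ℂ) : zetaTerm z =O[cobounded ℂ] fun w ↦ w⁻¹ ^ 4 := by
  have hinv : Tendsto (fun w : ℂ ↦ w⁻¹) (cobounded ℂ) (𝓝 0) := tendsto_inv₀_cobounded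
  have hlim : Tendsto (fun w : ℂ ↦ z ^ 2 * w⁻¹ ^ 2 - 1) (cobounded ℂ) (𝓝 (-1)) := by
    simpa using ((hinv.pow 2).const_mul (z ^ 2)).sub_const 1
  have hbound := (((hlim.inv₀ (by norm_num)).isBigO_one ℂ).const_mul_left (z ^ 3)).mul
    (Asymptotics.isBigO_refl (fun w : ℂ ↦ w⁻¹ ^ 4) (cobounded ℂ))
  refine hbound.congr' ?_ (.of_forall fun w ↦ one_mul _)
  filter_upwards [Bornology.eventually_ne_cobounded (0 : ℂ),
    hlim.eventually_ne (by norm_num : (-1 : ℂ) ≠ 0)] with w hw hne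
  have hfactor : z ^ 2 * w⁻¹ ^ 2 - 1 = (z ^ 2 - w ^ 2) / w ^ 2 := by field_simp
  rw [hfactor] at hne ⊢
  have hzw : z ^ 2 - w ^ 2 ≠ 0 := fun h ↦ hne (by rw [h, zero_div])
  rw [zetaTerm]
  field_simp
  ring

theorem isBigO_inv_lattice (τ : ℍ) :
    (fun x : Fin 2 → ℤ ↦ ((x 0 : ℂ) * τ + x 1)⁻¹) =O[cofinite] fun x ↦ ‖x‖⁻¹ := by
  simpa using EisensteinSeries.isBigO_linear_add_const_vec τ 0 0

theorem tendsto_lattice_cofinite_cobounded (τ : ℍ) :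
    Tendsto (fun x : Fin 2 → ℤ ↦ (x 0 : ℂ) * τ + x 1) cofinite (cobounded ℂ) := by
  have hnorm : Tendsto (fun x : Fin 2 → ℤ ↦ ‖x‖⁻¹) cofinite (𝓝 0) := by
    rw [← Filter.cocompact_eq_cofinite]
    exact tendsto_inv_atTop_zero.comp (tendsto_norm_cocompact_atTop (E := Fin 2 → ℤ))
  have hne : ∀ᶠ x : Fin 2 → ℤ in cofinite, ((x 0 : ℂ) * τ + x 1)⁻¹ ≠ 0 := by
    filter_upwards [(Set.finite_singleton (0 : Fin 2 → ℤ)).compl_mem_cofinite] with x hx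
    have hcast : (fun i ↦ (x i : ℝ)) ≠ 0 := fun h ↦
      hx (funext fun i ↦ by simpa using congrFun h i)
    exact inv_ne_zero (mod_cast UpperHalfPlane.linear_ne_zero τ hcast)
  have hinv : Tendsto (fun x : Fin 2 → ℤ ↦ ((x 0 : ℂ) * τ + x 1)⁻¹) cofinite (𝓝[≠] 0) :=
    tendsto_nhdsWithin_iff.mpr ⟨(isBigO_inv_lattice τ).trans_tendsto hnorm, hne⟩
  simpa only [Function.comp_def, inv_inv] using tendsto_inv₀_nhdsNE_zero.comp hinv

theorem summable_zetaTerm (z : ℂ) (τ : ℍ) :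
    Summable fun x : Fin 2 → ℤ ↦ zetaTerm z (x 0 * τ + x 1) := by
  refine EisensteinSeries.summable_of_isBigO_rpow_norm (a := 4) (by norm_num) ?_
  refine (((isBigO_zetaTerm z).comp_tendsto (tendsto_lattice_cofinite_cobounded τ)).trans
    ((isBigO_inv_lattice τ).pow 4)).congr_right fun x ↦ ?_
  rw [inv_pow]
  norm_cast

theorem latticeZeta_S_smul (z : ℂ) (τ : ℍ) :
    latticeZeta (z / τ) (S • τ) = τ * latticeZeta z τ := by
  let e : (Fin 2 → ℤ) ≃ (Fin 2 → ℤ) :=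
    { toFun := fun x ↦ ![x 1, -x 0]
      invFun := fun x ↦ ![-x 1, x 0]
      left_inv := fun x ↦ by ext i; fin_cases i <;> simp
      right_inv := fun x ↦ by ext i; fin_cases i <;> simp }
  have he (x : Fin 2 → ℤ) :
      (x 0 : ℂ) * (S • τ : ℍ) + x 1 = ((e x 0 : ℤ) * τ + (e x 1 : ℤ)) / τ := by
    have hτ := τ.ne_zero
    change _ = ((x 1 : ℤ) * (τ : ℂ) + (-x 0 : ℤ)) / τ
    rw [coe_S_smul]
    push_cast
    field_simp
    ring
  rw [latticeZeta, latticeZeta, ← tsum_mul_left,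
    ← e.tsum_eq fun x : Fin 2 → ℤ ↦ (τ : ℂ) * zetaTerm z (x 0 * τ + x 1)]
  exact tsum_congr fun x ↦ by rw [he, zetaTerm_div_mul _ _ _ τ.ne_zero]

theorem tsum_add_inv_eq_cot {a b : ℂ} (ha : a ∈ integerComplement)
    (hb : b ∈ integerComplement) (hs : Summable fun n : ℤ ↦ 1 / (b - n) + 1 / (a + n)) :
    ∑' n : ℤ, (1 / (b - n) + 1 / (a + n)) = π * cot (π * a) + π * cot (π * b) := by
  have hsum {x : ℂ} (hx : x ∈ integerComplement) :
      Summable fun n : ℕ+ ↦ 1 / (x - n) + 1 / (x + n) := by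
    rw [summable_pnat_iff_summable_succ (f := fun n : ℕ ↦ 1 / (x - n) + 1 / (x + n))]
    simpa [cotTerm] using summable_cotTerm hx
  have hpos := hs.comp_injective (i := fun n : ℕ+ ↦ (n : ℤ)) fun m n h ↦ by simpa using h
  have hneg := hs.comp_injective (i := fun n : ℕ+ ↦ -(n : ℤ)) fun m n h ↦ by simpa using h
  rw [Function.comp_def] at hpos hneg
  rw [cot_series_rep ha, cot_series_rep hb, add_add_add_comm, ← (hsum ha).tsum_add (hsum hb),
    tsum_int_eq_zero_add_tsum_pnat hs, add_assoc, ← hpos.tsum_add hneg, Int.cast_zero,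
    sub_zero, add_zero, add_comm (1 / b)]
  refine congrArg _ (tsum_congr fun n ↦ ?_)
  push_cast
  ring

theorem div_sq_sub_sq {z w : ℂ} (hsub : z - w ≠ 0) (hadd : z + w ≠ 0) :
    z / (z ^ 2 - w ^ 2) = 1 / 2 * (1 / (z - w) + 1 / (z + w)) := by
  rw [sq_sub_sq]
  field_simp
  ring

theorem tsum_div_sq_sub_sq_eq_cot {z a : ℂ} (hadd : z + a ∈ integerComplement)
    (hsub : z - a ∈ integerComplement) (hs : Summable fun n : ℤ ↦ z / (z ^ 2 - (a + n) ^ 2)) :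
    ∑' n : ℤ, z / (z ^ 2 - (a + n) ^ 2) =
      1 / 2 * (π * cot (π * (z + a)) + π * cot (π * (z - a))) := by
  have hterm (n : ℤ) :
      z / (z ^ 2 - (a + n) ^ 2) = 1 / 2 * (1 / (z - a - n) + 1 / (z + a + n)) := by
    have hneg := Complex.integerComplement_add_ne_zero hsub (-n)
    rw [Int.cast_neg, ← sub_eq_add_neg, sub_sub] at hneg
    have hpos := Complex.integerComplement_add_ne_zero hadd n
    rw [add_assoc] at hpos
    rw [div_sq_sub_sq hneg hpos, sub_sub, add_assoc]
  simp only [hterm] at hs ⊢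
  rw [tsum_mul_left, tsum_add_inv_eq_cot hadd hsub ((summable_mul_left_iff (by norm_num)).mp hs)]

variable {z : ℂ} {τ : ℍ}

theorem hasSum_cot_latticeZeta (hz : ∀ m : ℤ, z + m * τ ∈ integerComplement) :
    HasSum (fun m : ℤ ↦ 1 / 2 * (π * cot (π * (z + m * τ)) + π * cot (π * (z - m * τ))))
      (latticeZeta z τ - z * EisensteinSeries.G2 τ) (SummationFilter.symmetricIcc ℤ) := by
  have hs : Summable fun p : ℤ × ℤ ↦ zetaTerm z (p.1 * τ + p.2) :=
    (finTwoArrowEquiv ℤ).symm.summable_iff.mpr (summable_zetaTerm z τ)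
  have hzeta : HasSum (fun p : ℤ × ℤ ↦ zetaTerm z (p.1 * τ + p.2)) (latticeZeta z τ) := by
    rw [latticeZeta, ← (finTwoArrowEquiv ℤ).symm.tsum_eq]
    exact hs.hasSum
  have hrows := (hzeta.prod_fiberwise fun m ↦ (hs.prod_factor m).hasSum).mono_left
    (SummationFilter.symmetricIcc ℤ).le_atTop
  refine HasSum.congr_fun (HasSum.sub hrows
    ((EisensteinSeries.summable_e2Summand_symmetricIcc τ).hasSum.mul_left z)) fun m ↦ ?_
  have hG := (EisensteinSeries.e2Summand_summable m τ).mul_left z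
  have hterm (n : ℤ) : zetaTerm z (m * τ + n) - z * EisensteinSeries.eisSummand 2 ![m, n] τ =
      z / (z ^ 2 - (m * τ + n) ^ 2) := by
    rw [zetaTerm, EisensteinSeries.eisSummand, zpow_neg, div_eq_mul_inv z (_ ^ 2)]
    exact add_sub_cancel_right _ _
  have hsub : z - m * τ ∈ integerComplement := by
    simpa only [Int.cast_neg, neg_mul, ← sub_eq_add_neg] using hz (-m)
  have hsum := (hs.prod_factor m).sub hG
  rw [EisensteinSeries.e2Summand, ← tsum_mul_left, ← (hs.prod_factor m).tsum_sub hG]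
  simp only [hterm] at hsum ⊢
  exact (tsum_div_sq_sub_sq_eq_cot (hz m) hsub hsum).symm

theorem tendsto_cot_latticeZeta (hz : ∀ m : ℤ, z + m * τ ∈ integerComplement) :
    Tendsto (fun N : ℕ ↦ π * cot (π * z) + ∑ m ∈ Finset.range N,
      (π * cot (π * (z + (m + 1 : ℕ) * τ)) + π * cot (π * (z - (m + 1 : ℕ) * τ)))) atTop
      (𝓝 (latticeZeta z τ - z * EisensteinSeries.G2 τ)) := by
  have h := hasSum_cot_latticeZeta hz
  rw [HasSum, SummationFilter.symmetricIcc_eq_map_Icc_nat, tendsto_map'_iff] at h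
  refine h.congr fun N ↦ ?_
  rw [Function.comp_apply, Finset.sum_Icc_of_even_eq_range (fun m ↦ by push_cast; ring_nf),
    Finset.sum_range_succ', smul_add, Finset.smul_sum]
  simp only [nsmul_eq_mul, Int.cast_natCast, Int.cast_zero, Nat.cast_zero, zero_mul, add_zero,
    sub_zero, Nat.cast_ofNat]
  rw [add_sub_assoc, add_comm]
  congr 1
  · ring
  · exact Finset.sum_congr rfl fun m _ ↦ by ring

end Zeta

section Lambert

/-- The sum of `χ(d)` over the divisors `d` of `n`: the coefficient of `qⁿ` in an Eisenstein series
of weight one. -/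
def divisorSum (χ : ℕ → ℂ) (n : ℕ) : ℂ := ∑ d ∈ n.divisors, χ d

variable {χ : ℕ → ℂ} {q : ℂ}

theorem norm_divisorSum_le (hχ : ∀ n, ‖χ n‖ ≤ 1) (n : ℕ) : ‖divisorSum χ n‖ ≤ n ^ 1 := by
  refine (norm_sum_le_of_le _ fun d _ ↦ hχ d).trans ?_
  rw [Finset.sum_const, nsmul_eq_mul, mul_one, pow_one]
  exact_mod_cast Nat.card_divisors_le_self n

theorem sum_divisorsAntidiagonal_mul_pow (χ : ℕ → ℂ) (q : ℂ) (n : ℕ) :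
    ∑ x ∈ n.divisorsAntidiagonal, χ x.2 * q ^ (x.1 * x.2) = divisorSum χ n * q ^ n := by
  rw [Nat.sum_divisorsAntidiagonal' fun x y ↦ χ y * q ^ (x * y), divisorSum, Finset.sum_mul]
  exact Finset.sum_congr rfl fun d hd ↦ by rw [Nat.div_mul_cancel (Nat.dvd_of_mem_divisors hd)]

theorem hasSum_lambert (hχ : ∀ n, ‖χ n‖ ≤ 1) (hq : ‖q‖ < 1) :
    HasSum (fun c : ℕ+ × ℕ+ ↦ χ c.2 * q ^ (c.1 * c.2 : ℕ))
      (∑' n : ℕ+, divisorSum χ n * q ^ (n : ℕ)) := by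
  have hs : Summable fun c : ℕ+ × ℕ+ ↦ χ c.2 * q ^ (c.1 * c.2 : ℕ) := by
    refine Summable.of_norm_bounded (summable_prod_mul_pow 0 hq).norm fun c ↦ ?_
    rw [norm_mul, pow_zero, one_mul]
    exact mul_le_of_le_one_left (norm_nonneg _) (hχ _)
  convert! hs.hasSum using 1
  rw [← ((sigmaAntidiagonalEquivProd.hasSum_iff.mpr hs.hasSum).sigma
    fun _ ↦ hasSum_fintype _).tsum_eq]
  refine tsum_congr fun n ↦ ?_
  rw [← sum_divisorsAntidiagonal_mul_pow]
  exact ((n : ℕ).divisorsAntidiagonal.sum_attach fun x ↦ χ x.2 * q ^ (x.1 * x.2)).symm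

theorem hasSum_lambert_row (hχ : ∀ n, ‖χ n‖ ≤ 1) (hq : ‖q‖ < 1) :
    HasSum (fun m : ℕ+ ↦ ∑' k : ℕ+, χ k * (q ^ (m : ℕ)) ^ (k : ℕ))
      (∑' n : ℕ+, divisorSum χ n * q ^ (n : ℕ)) := by
  refine (hasSum_lambert hχ hq).prod_fiberwise fun m ↦ ?_
  simpa only [pow_mul] using ((hasSum_lambert hχ hq).summable.prod_factor m).hasSum

theorem summable_pnat_pow (hq : ‖q‖ < 1) : Summable fun k : ℕ+ ↦ q ^ (k : ℕ) :=
  (summable_geometric_of_norm_lt_one hq).comp_injective PNat.coe_injective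

theorem hasSum_lambert_col (hχ : ∀ n, ‖χ n‖ ≤ 1) (hq : ‖q‖ < 1) :
    HasSum (fun d : ℕ+ ↦ χ d * ∑' k : ℕ+, (q ^ (d : ℕ)) ^ (k : ℕ))
      (∑' n : ℕ+, divisorSum χ n * q ^ (n : ℕ)) := by
  refine ((Equiv.prodComm ℕ+ ℕ+).hasSum_iff.mpr (hasSum_lambert hχ hq)).prod_fiberwise fun d ↦ ?_
  have hqd : ‖q ^ (d : ℕ)‖ < 1 := by
    rw [norm_pow]
    exact pow_lt_one₀ (norm_nonneg q) hq d.ne_zero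
  simpa only [← pow_mul, Function.comp_apply, Equiv.prodComm_apply, Prod.swap, mul_comm] using
    (summable_pnat_pow hqd).hasSum.mul_left (χ d)

theorem tendsto_sum_range_of_hasSum_pnat {f : ℕ → ℂ} {a : ℂ} (h : HasSum (fun n : ℕ+ ↦ f n) a) :
    Tendsto (fun N ↦ ∑ n ∈ Finset.range N, f (n + 1)) atTop (𝓝 a) :=
  (Equiv.pnatEquivNat.symm.hasSum_iff.mpr h).tendsto_sum_nat

end Lambert

section WeightOne

variable {N : ℕ} (χ : DirichletCharacter ℂ N)

theorem eisensteinWeightOne_eq_qSeries :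
    eisensteinWeightOne χ =
      fun τ ↦ 1 - 2 / bernoulliOne χ * qSeries (divisorSum fun n ↦ χ n) τ :=
  rfl

theorem mdifferentiable_eisensteinWeightOne : MDiff (eisensteinWeightOne χ) :=
  mdifferentiable_const.sub (mdifferentiable_const.mul (mdifferentiable_qSeries
    (norm_divisorSum_le fun n ↦ χ.norm_le_one n) (by simp [divisorSum])))

theorem tendsto_eisensteinWeightOne : Tendsto (eisensteinWeightOne χ) atImInfty (𝓝 1) := by
  rw [eisensteinWeightOne_eq_qSeries]
  simpa using ((tendsto_qSeries (norm_divisorSum_le fun n ↦ χ.norm_le_one n)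
    (by simp [divisorSum])).const_mul (2 / bernoulliOne χ)).const_sub 1

theorem eisensteinWeightOne_slash_T (k : ℤ) :
    eisensteinWeightOne χ ∣[k] T = eisensteinWeightOne χ := by
  ext τ
  have hq := congrFun (qSeries_slash_T (divisorSum fun n ↦ χ n) k) τ
  rw [slash_T_apply] at hq ⊢
  simp only [eisensteinWeightOne_eq_qSeries, hq]

end WeightOne

section Cotangent

open Complex (cot)

theorem pi_mul_cot_eq_tsum_pnat {a : ℂ} (ha : 0 < a.im) :
    π * cot (π * a) = -π * Complex.I -
      2 * π * Complex.I * ∑' k : ℕ+, Complex.exp (2 * π * Complex.I * a) ^ (k : ℕ) := by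
  have h : π * cot (π * a) = π * Complex.I -
      2 * π * Complex.I * ∑' k : ℕ, Complex.exp (2 * π * Complex.I * a) ^ k :=
    pi_mul_cot_pi_q_exp ⟨a, ha⟩
  rw [h, ← tsum_zero_pnat_eq_tsum_nat (f := fun k ↦ Complex.exp (2 * π * Complex.I * a) ^ k)
    (summable_geometric_of_norm_lt_one (norm_exp_two_pi_I_lt_one ⟨a, ha⟩)), pow_zero]
  ring

theorem pi_mul_cot_add_cot {z w : ℂ} (hadd : 0 < (w + z).im) (hsub : 0 < (w - z).im) :
    π * cot (π * (z + w)) + π * cot (π * (z - w)) = -2 * π * Complex.I *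
      (∑' k : ℕ+, Complex.exp (2 * π * Complex.I * (w + z)) ^ (k : ℕ) -
        ∑' k : ℕ+, Complex.exp (2 * π * Complex.I * (w - z)) ^ (k : ℕ)) := by
  have hodd : cot (π * (z - w)) = -cot (π * (w - z)) := by
    rw [← neg_sub w z, mul_neg, Complex.cot, Complex.cot, Complex.cos_neg, Complex.sin_neg, div_neg]
  rw [hodd, mul_neg, add_comm z w, pi_mul_cot_eq_tsum_pnat hadd, pi_mul_cot_eq_tsum_pnat hsub]
  ring

theorem cot_pi_mul_third : cot (π * (1 / 3)) = 1 / √3 := by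
  rw [mul_one_div, Complex.cot, ← Complex.ofReal_ofNat, ← Complex.ofReal_div, ← Complex.ofReal_cos,
    ← Complex.ofReal_sin, ← Complex.ofReal_div, Real.cos_pi_div_three, Real.sin_pi_div_three]
  push_cast
  field_simp

theorem ofReal_sqrt_three_sq : (√3 : ℂ) ^ 2 = 3 := by
  exact_mod_cast Real.sq_sqrt (show (0 : ℝ) ≤ 3 by norm_num)

theorem exp_two_pi_mul_I_div_three :
    Complex.exp (2 * π * Complex.I / 3) = (-1 + √3 * Complex.I) / 2 := by
  have hsixth : Complex.exp (↑(π / 3) * Complex.I) = (1 + √3 * Complex.I) / 2 := by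
    rw [Complex.exp_mul_I, ← Complex.ofReal_cos, ← Complex.ofReal_sin, Real.cos_pi_div_three,
      Real.sin_pi_div_three]
    push_cast
    ring
  have hsq : 2 * π * Complex.I / 3 = (2 : ℕ) * (↑(π / 3) * Complex.I) := by
    push_cast
    ring
  rw [hsq, Complex.exp_nat_mul, hsixth]
  linear_combination (Complex.I ^ 2 * ofReal_sqrt_three_sq + 3 * Complex.I_sq) / 4

end Cotangent

section LevelThree

open Complex (cot integerComplement)

theorem chiThree_natCast (n : ℕ) :
    chiThree (n : ZMod 3) = if n % 3 = 0 then 0 else if n % 3 = 1 then 1 else -1 := by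
  have hchar (x : ZMod 3) :
      quadraticChar (ZMod 3) x = if x = 0 then 0 else if x = 1 then 1 else -1 := by
    revert x
    decide
  have h0 : (n : ZMod 3) = 0 ↔ n % 3 = 0 := by
    rw [ZMod.natCast_eq_zero_iff, Nat.dvd_iff_mod_eq_zero]
  have h1 : (n : ZMod 3) = 1 ↔ n % 3 = 1 := by
    rw [← Nat.cast_one, ZMod.natCast_eq_natCast_iff']
  rw [chiThree, MulChar.ringHomComp_apply, hchar]
  simp only [h0, h1]
  split_ifs <;> simp

theorem bernoulliOne_chiThree : bernoulliOne chiThree = -1 / 3 := by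
  rw [bernoulliOne, Finset.sum_Icc_succ_top (by norm_num), Finset.sum_Icc_succ_top (by norm_num),
    Finset.Icc_self, Finset.sum_singleton]
  simp only [chiThree_natCast]
  norm_num

theorem eisensteinWeightOne_chiThree (τ : ℍ) :
    eisensteinWeightOne chiThree τ = 1 + 6 * qSeries (divisorSum fun n ↦ chiThree n) τ := by
  rw [eisensteinWeightOne_eq_qSeries, bernoulliOne_chiThree]
  ring

theorem exp_pow_sub_exp_neg_pow (k : ℕ) :
    Complex.exp (2 * π * Complex.I / 3) ^ k - Complex.exp (-(2 * π * Complex.I / 3)) ^ k =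
      √3 * Complex.I * chiThree k := by
  have hcube : Complex.exp (2 * π * Complex.I / 3) ^ 3 = 1 := by
    rw [← Complex.exp_nat_mul, Nat.cast_ofNat, mul_div_cancel₀ _ three_ne_zero,
      Complex.exp_two_pi_mul_I]
  have hneg : Complex.exp (-(2 * π * Complex.I / 3)) = Complex.exp (2 * π * Complex.I / 3) ^ 2 := by
    rw [Complex.exp_neg]
    exact inv_eq_of_mul_eq_one_right (by rw [← pow_succ', hcube])
  have hdiff : Complex.exp (2 * π * Complex.I / 3) - Complex.exp (2 * π * Complex.I / 3) ^ 2 =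
      √3 * Complex.I := by
    rw [exp_two_pi_mul_I_div_three]
    linear_combination -(Complex.I ^ 2 * ofReal_sqrt_three_sq + 3 * Complex.I_sq) / 4
  rw [hneg, ← pow_mul, pow_eq_pow_mod k hcube, pow_eq_pow_mod (2 * k) hcube, Nat.mul_mod,
    chiThree_natCast]
  have hmod : k % 3 = 0 ∨ k % 3 = 1 ∨ k % 3 = 2 := by omega
  rcases hmod with hk | hk | hk <;> norm_num [hk]
  · exact hdiff
  · rw [← hdiff, neg_sub]

theorem im_natCast_mul_pos (n : ℕ) [NeZero n] {z : ℂ} (hz : 0 < z.im) : 0 < (n * z).im := by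
  simpa using mul_pos (Nat.cast_pos.mpr (Nat.pos_of_neZero n) : (0 : ℝ) < n) hz

theorem third_add_mem_integerComplement (τ : ℍ) (m : ℤ) :
    (1 / 3 : ℂ) + m * τ ∈ integerComplement := by
  rintro ⟨n, hn⟩
  have hm : (m : ℂ) = 0 := by
    simpa [τ.im_pos.ne'] using congrArg Complex.im hn
  rw [hm, zero_mul, add_zero, eq_div_iff three_ne_zero] at hn
  have : n * 3 = 1 := mod_cast hn
  omega

theorem div_three_add_mem_integerComplement (τ : ℍ) (m : ℤ) :
    (τ : ℂ) / 3 + m * τ ∈ integerComplement := by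
  rintro ⟨n, hn⟩
  have him : (1 + 3 * m : ℝ) * τ.im = 0 := by
    have hn' : (0 : ℝ) = τ.im / 3 + m * τ.im := by simpa using congrArg Complex.im hn
    linarith
  have : 1 + 3 * m = 0 := mod_cast (mul_eq_zero.mp him).resolve_right τ.im_pos.ne'
  omega

theorem pi_mul_cot_third_add (τ : ℍ) (m : ℕ) :
    π * cot (π * (1 / 3 + (m + 1 : ℕ) * τ)) + π * cot (π * (1 / 3 - (m + 1 : ℕ) * τ)) =
      2 * π * √3 * ∑' k : ℕ+, chiThree ((k : ℕ) : ZMod 3) *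
        (Complex.exp (2 * π * Complex.I * τ) ^ (m + 1)) ^ (k : ℕ) := by
  have him : 0 < ((m + 1 : ℕ) * (τ : ℂ)).im := im_natCast_mul_pos _ τ.im_pos
  have hadd : 0 < ((m + 1 : ℕ) * (τ : ℂ) + 1 / 3).im := by simpa using him
  have hsub : 0 < ((m + 1 : ℕ) * (τ : ℂ) - 1 / 3).im := by simpa using him
  have hexp (a : ℂ) : Complex.exp (2 * π * Complex.I * ((m + 1 : ℕ) * τ + a)) =
      Complex.exp (2 * π * Complex.I * τ) ^ (m + 1) * Complex.exp (2 * π * Complex.I * a) := by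
    rw [← Complex.exp_nat_mul, ← Complex.exp_add]
    congr 1
    ring
  have hs {a : ℂ} (ha : 0 < a.im) :
      Summable fun k : ℕ+ ↦ Complex.exp (2 * π * Complex.I * a) ^ (k : ℕ) :=
    summable_pnat_pow (norm_exp_two_pi_I_lt_one ⟨a, ha⟩)
  rw [pi_mul_cot_add_cot hadd hsub, ← (hs hadd).tsum_sub (hs hsub), ← tsum_mul_left,
    ← tsum_mul_left]
  refine tsum_congr fun k ↦ ?_
  rw [sub_eq_add_neg _ (1 / 3 : ℂ), hexp, hexp, mul_pow _ (Complex.exp _),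
    mul_pow _ (Complex.exp _), ← mul_sub, mul_neg, mul_one_div, exp_pow_sub_exp_neg_pow]
  linear_combination -2 * π * √3 * chiThree ((k : ℕ) : ZMod 3) *
    (Complex.exp (2 * π * Complex.I * τ) ^ (m + 1)) ^ (k : ℕ) * Complex.I_sq

theorem latticeZeta_third (τ : ℍ) :
    latticeZeta (1 / 3) τ - 1 / 3 * EisensteinSeries.G2 τ =
      π / √3 * eisensteinWeightOne chiThree τ := by
  have hcot := tendsto_cot_latticeZeta (third_add_mem_integerComplement τ)
  have hseries := ((tendsto_sum_range_of_hasSum_pnat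
    (f := fun m ↦ ∑' k : ℕ+, chiThree ((k : ℕ) : ZMod 3) *
      (Complex.exp (2 * π * Complex.I * τ) ^ m) ^ (k : ℕ))
    (hasSum_lambert_row (χ := fun n ↦ chiThree n) (fun n ↦ chiThree.norm_le_one n)
      (norm_exp_two_pi_I_lt_one τ))).const_mul (2 * π * √3 : ℂ)).const_add (π * cot (π * (1 / 3)))
  simp only [pi_mul_cot_third_add, ← Finset.mul_sum] at hcot
  rw [tendsto_nhds_unique hcot hseries, ← qSeries, eisensteinWeightOne_chiThree, cot_pi_mul_third]
  have hsqrt0 : (√3 : ℂ) ≠ 0 := by simp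
  field_simp
  rw [ofReal_sqrt_three_sq]
  ring

theorem sum_range_chiThree_mul (f : ℕ → ℂ) (N : ℕ) :
    ∑ d ∈ Finset.range (3 * N + 1), chiThree (d + 1 : ℕ) * f (d + 1) =
      f 1 + ∑ m ∈ Finset.range N, (f (3 * m + 4) - f (3 * m + 2)) := by
  induction N with
  | zero => simp
  | succ N ih =>
    have h2 : chiThree (3 * N + 1 + 1 : ℕ) = -1 := by
      rw [chiThree_natCast, if_neg (by omega), if_neg (by omega)]
    have h3 : chiThree (3 * N + 1 + 1 + 1 : ℕ) = 0 := by
      rw [chiThree_natCast, if_pos (by omega)]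
    have h4 : chiThree (3 * N + 1 + 1 + 1 + 1 : ℕ) = 1 := by
      rw [chiThree_natCast, if_neg (by omega), if_pos (by omega)]
    rw [show 3 * (N + 1) + 1 = 3 * N + 1 + 1 + 1 + 1 by ring, Finset.sum_range_succ,
      Finset.sum_range_succ, Finset.sum_range_succ, ih, h2, h3, h4, Finset.sum_range_succ]
    ring

theorem pi_mul_cot_div_three_add (τ : ℍ) (m : ℕ) :
    π * cot (π * (τ / 3 + (m + 1 : ℕ) * τ)) + π * cot (π * (τ / 3 - (m + 1 : ℕ) * τ)) =
      -2 * π * Complex.I *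
        (∑' k : ℕ+, (Complex.exp (2 * π * Complex.I * (τ / 3)) ^ (3 * m + 4)) ^ (k : ℕ) -
          ∑' k : ℕ+, (Complex.exp (2 * π * Complex.I * (τ / 3)) ^ (3 * m + 2)) ^ (k : ℕ)) := by
  have him (n : ℕ) [NeZero n] : 0 < (n * ((τ : ℂ) / 3)).im := by
    have : 0 < ((τ : ℂ) / 3).im := by simpa using τ.im_pos
    exact im_natCast_mul_pos n this
  have hexp (n : ℕ) : Complex.exp (2 * π * Complex.I * (n * (τ / 3))) =
      Complex.exp (2 * π * Complex.I * (τ / 3)) ^ n := by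
    rw [← Complex.exp_nat_mul]
    congr 1
    ring
  have hadd : ((m + 1 : ℕ) * (τ : ℂ) + τ / 3) = (3 * m + 4 : ℕ) * (τ / 3) := by
    push_cast
    ring
  have hsub : ((m + 1 : ℕ) * (τ : ℂ) - τ / 3) = (3 * m + 2 : ℕ) * (τ / 3) := by
    push_cast
    ring
  rw [pi_mul_cot_add_cot (hadd ▸ him _) (hsub ▸ him _), hadd, hsub, hexp, hexp]

theorem latticeZeta_div_three (τ : ℍ) :
    latticeZeta (τ / 3) τ - τ / 3 * EisensteinSeries.G2 τ + 2 * π * Complex.I / 3 =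
      -(π * Complex.I / 3) *
        rescale (1 / 3) (one_div_pos.mpr three_pos) (eisensteinWeightOne chiThree) τ := by
  let f (d : ℕ) : ℂ := ∑' k : ℕ+, (Complex.exp (2 * π * Complex.I * (τ / 3)) ^ d) ^ (k : ℕ)
  have him : 0 < ((τ : ℂ) / 3).im := by simpa using τ.im_pos
  have hcot := tendsto_cot_latticeZeta (div_three_add_mem_integerComplement τ)
  have hpartial (N : ℕ) : π * cot (π * (τ / 3)) + ∑ m ∈ Finset.range N,
      (π * cot (π * (τ / 3 + (m + 1 : ℕ) * τ)) + π * cot (π * (τ / 3 - (m + 1 : ℕ) * τ))) =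
      -π * Complex.I - 2 * π * Complex.I *
        ∑ d ∈ Finset.range (3 * N + 1), chiThree (d + 1 : ℕ) * f (d + 1) := by
    rw [sum_range_chiThree_mul f N, pi_mul_cot_eq_tsum_pnat him,
      Finset.sum_congr rfl fun m _ ↦ pi_mul_cot_div_three_add τ m, ← Finset.mul_sum]
    simp only [f, pow_one]
    ring
  have htop : Tendsto (fun N : ℕ ↦ 3 * N + 1) atTop atTop :=
    tendsto_atTop_mono (fun N ↦ (by omega : N ≤ 3 * N + 1)) tendsto_id
  have hseries := (((tendsto_sum_range_of_hasSum_pnat (f := fun d ↦ chiThree d * f d)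
    (hasSum_lambert_col (χ := fun n ↦ chiThree n) (fun n ↦ chiThree.norm_le_one n)
      (norm_exp_two_pi_I_lt_one ⟨_, him⟩))).comp htop).const_mul
    (2 * π * Complex.I)).const_sub (-π * Complex.I)
  have hcoe : (((⟨1 / 3, one_div_pos.mpr three_pos⟩ : {x : ℝ // 0 < x}) • τ : ℍ) : ℂ) = τ / 3 := by
    rw [coe_pos_smul]
    push_cast
    ring
  rw [tendsto_nhds_unique (hcot.congr hpartial) hseries, rescale, eisensteinWeightOne_chiThree,
    qSeries, hcoe]
  ring

theorem eisensteinWeightOne_chiThree_slash_S :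
    eisensteinWeightOne chiThree ∣[(1 : ℤ)] S = (-(Complex.I / √3) : ℂ) •
      rescale (1 / 3) (one_div_pos.mpr three_pos) (eisensteinWeightOne chiThree) := by
  ext τ
  have hτ := τ.ne_zero
  have hsqrt0 : (√3 : ℂ) ≠ 0 := by simp
  have hG : EisensteinSeries.G2 (S • τ) =
      τ ^ 2 * EisensteinSeries.G2 τ - 2 * π * Complex.I * τ := by
    rw [EisensteinSeries.G2_S_transform τ]
    field_simp
    ring
  have hzeta := latticeZeta_S_smul (τ / 3) τ
  rw [div_right_comm, div_self hτ] at hzeta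
  have hthird := latticeZeta_third (S • τ)
  rw [hzeta, hG] at hthird
  have hpi : (π : ℂ) ≠ 0 := Complex.ofReal_ne_zero.mpr Real.pi_ne_zero
  rw [slash_S_apply, zpow_neg_one, mul_inv_eq_iff_eq_mul₀ hτ, Pi.smul_apply, smul_eq_mul]
  refine mul_left_cancel₀ (div_ne_zero hpi hsqrt0) ?_
  rw [← hthird]
  have hscale (z : ℂ) : π / √3 * (-(Complex.I / √3) * z) = -(π * Complex.I / 3) * z := by
    rw [← ofReal_sqrt_three_sq]
    ring
  rw [← mul_assoc, hscale, ← latticeZeta_div_three]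
  ring

theorem isFrickeForm_eisensteinWeightOne_chiThree :
    IsFrickeForm (1 / 3) (one_div_pos.mpr three_pos) 1 (-(Complex.I / √3))
      (eisensteinWeightOne chiThree) where
  mdifferentiable := mdifferentiable_eisensteinWeightOne chiThree
  tendsto := tendsto_eisensteinWeightOne chiThree
  slash_T := eisensteinWeightOne_slash_T chiThree 1
  slash_S := eisensteinWeightOne_chiThree_slash_S

end LevelThree

end

theorem mainTheorem1 :
    (∃ e₁ e₂ f₁ f₂ : modularForms Γ(2) 2,
      (e₁ : ℍ → ℂ) = rescale (1 / 2) one_half_pos eisensteinTwoTwo ∧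
      (e₂ : ℍ → ℂ) = eisensteinTwoTwo ∧
      (f₁ : ℍ → ℂ) = etaLower 2 ^ 4 ∧
      (f₂ : ℍ → ℂ) = etaUpper 2 ^ 4 ∧
      IsPolynomialRingIn (ModularFormRing.ofForm e₁) (ModularFormRing.ofForm e₂) ∧
      IsPolynomialRingIn (ModularFormRing.ofForm f₁) (ModularFormRing.ofForm f₂)) ∧
    (∃ e₁ e₂ f₁ f₂ : modularForms Γ(3) 1,
      (e₁ : ℍ → ℂ) = rescale (1 / 3) (one_div_pos.mpr three_pos) (eisensteinWeightOne chiThree) ∧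
      (e₂ : ℍ → ℂ) = eisensteinWeightOne chiThree ∧
      (f₁ : ℍ → ℂ) = etaLower 3 ∧
      (f₂ : ℍ → ℂ) = etaUpper 3 ∧
      IsPolynomialRingIn (ModularFormRing.ofForm e₁) (ModularFormRing.ofForm e₂) ∧
      IsPolynomialRingIn (ModularFormRing.ofForm f₁) (ModularFormRing.ofForm f₂)) := by
  have hη₂ : IsEtaExponent 2 4 2 := ⟨by norm_num, by norm_num⟩
  have hη₃ : IsEtaExponent 3 1 1 := ⟨by norm_num, by norm_num⟩
  constructor
  · exact isFrickeForm_eisensteinTwoTwo.exists_isPolynomialRingIn (by norm_num) (by norm_num) hη₂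
  · simpa only [pow_one] using
      isFrickeForm_eisensteinWeightOne_chiThree.exists_isPolynomialRingIn (by simp) (by norm_num)
        hη₃
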